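/- Let $r>0$. Let $S^3_r=\{X\in\mathbb R^4: X_0^2+X_1^2+X_2^2+X_3^2=r^2\}$ with the metric induced from Euclidean four-space, let $H^3_r=\{X\in\mathbb R^4: X_0^2+X_1^2+X_2^2-X_3^2=-r^2,\ X_3>0\}$ with the metric induced from Minkowski space, and let $\mathrm{Euc}^3$ be flat three-space. For $\Sigma\in\{S^3_r,\mathrm{Euc}^3,H^3_r\}$ consider a regular geodesic tetrahedron $T\subset\Sigma$ of edge length $a$ (four vertices, all six geodesic edges of length $a$), where $0<a<\infty$ and, for $\Sigma=S^3_r$, $a<a_{\max}=2r\arctan\sqrt2$. Such tetrahedra exist for every such $a$. Let $V^\Sigma(r,a)$ be the Riemannian volume of $T$, $A^\Sigma(r,a)$ the Riemannian area of any one of its geodesic triangular faces, and $$\mathrm{VRA}^\Sigma(r,a)=\frac{V^\Sigma(r,a)}{A^\Sigma(r,a)^{3/2}} .$$ Put $c=\dfrac{\sqrt2}{12\,(\sqrt3/4)^{3/2}}$; then $|c-0.4136|<5\cdot10^{-5}$. For all admissible $(r,a)$, $$\mathrm{VRA}^{H^3_r}(r,a)\ \le\ \mathrm{VRA}^{\mathrm{Euc}^3}(r,a)=c\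 \le\ \mathrm{VRA}^{S^3_r}(r,a),$$ and the ratio decides the geometry of the space containing the tetrahedron: for a regular geodesic tetrahedron in $\Sigma\in\{S^3_r,\mathrm{Euc}^3,H^3_r\}$, $$\mathrm{VRA}^\Sigma>c\iff\Sigma=S^3_r,\qquad \mathrm{VRA}^\Sigma=c\iff\Sigma=\mathrm{Euc}^3,\qquad \mathrm{VRA}^\Sigma<c\iff\Sigma=H^3_r .$$ -/

import Mathlib

/-- The three kinds of three-dimensional geometry of constant curvature. -/
inductive SpaceKind where
  | spherical
  | euclidean
  | hyperbolic

/-- The sign `ε²` of the fourth coordinate in the ambient flat metric: `-1` for Minkowski space,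
which contains the hyperbolic space, and `1` for Euclidean four-space. -/
def SpaceKind.epsSq : SpaceKind → ℝ
  | .spherical => 1
  | .euclidean => 1
  | .hyperbolic => -1

/-- The ambient flat metric `X₀Y₀ + X₁Y₁ + X₂Y₂ + ε² X₃Y₃` on `ℝ⁴`. -/
def ambientForm (K : SpaceKind) (X Y : Fin 4 → ℝ) : ℝ :=
  X 0 * Y 0 + X 1 * Y 1 + X 2 * Y 2 + K.epsSq * (X 3 * Y 3)

/-- The space of constant curvature, with radius of curvature `r`, as a hypersurface of `ℝ⁴`:
the sphere of radius `r` in Euclidean four-space, the flat hyperplane `X₃ = 0` in Euclidean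
four-space (here `r` plays no role), or the upper sheet of the hyperboloid of radius `r` in
Minkowski space. Its Riemannian metric is the one induced by `ambientForm`. -/
def modelSpace (K : SpaceKind) (r : ℝ) : Set (Fin 4 → ℝ) :=
  match K with
  | .spherical => {X | ambientForm .spherical X X = r ^ 2}
  | .euclidean => {X | X 3 = 0}
  | .hyperbolic => {X | ambientForm .hyperbolic X X = -r ^ 2 ∧ 0 < X 3}

/-- The central projection to the sphere, respectively the hyperboloid. It maps affine segments,
triangles and tetrahedra of the ambient space to geodesic ones. (No projection is needed in the
flat case.) -/
noncomputable def centralProj (K : SpaceKind) (r : ℝ) (X : Fin 4 → ℝ) : Fin 4 → ℝ :=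
  match K with
  | .spherical => (r / √|ambientForm .spherical X X|) • X
  | .euclidean => X
  | .hyperbolic => (r / √|ambientForm .hyperbolic X X|) • X

/-- The parameter domain `{t : tᵢ ≥ 0, ∑ tᵢ ≤ 1}` of a `k`-simplex. -/
def cornerSimplex (k : ℕ) : Set (Fin k → ℝ) :=
  {t | (∀ i, 0 ≤ t i) ∧ ∑ i, t i ≤ 1}

/-- The parametrization over `cornerSimplex k` of the geodesic `k`-simplex with vertices
`P 0, …, P k`. -/
noncomputable def geodesicSimplex (K : SpaceKind) (r : ℝ) {k : ℕ}
    (P : Fin (k + 1) → Fin 4 → ℝ) (t : Fin k → ℝ) : Fin 4 → ℝ :=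
  centralProj K r ((1 - ∑ i, t i) • P 0 + ∑ i, t i • P i.succ)

/-- The matrix of the induced Riemannian metric of the geodesic simplex in the coordinates `t`. -/
noncomputable def inducedMetric (K : SpaceKind) (r : ℝ) {k : ℕ}
    (P : Fin (k + 1) → Fin 4 → ℝ) (t : Fin k → ℝ) : Matrix (Fin k) (Fin k) ℝ :=
  Matrix.of fun i j => ambientForm K
    (fderiv ℝ (geodesicSimplex K r P) t (Pi.single i 1))
    (fderiv ℝ (geodesicSimplex K r P) t (Pi.single j 1))

/-- The `k`-dimensional Riemannian measure `∫ √|det g|` of the geodesic simplex with vertices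
`P 0, …, P k`: the length of a geodesic segment (`k = 1`), the area of a geodesic triangle
(`k = 2`), the volume of a geodesic tetrahedron (`k = 3`). -/
noncomputable def simplexMeasure (K : SpaceKind) (r : ℝ) {k : ℕ}
    (P : Fin (k + 1) → Fin 4 → ℝ) : ℝ :=
  ∫ t in cornerSimplex k, √|(inducedMetric K r P t).det|

/-- The possible edge lengths of a nondegenerate regular tetrahedron: all positive numbers, bounded
on the sphere by the maximal edge length `2 r arctan √2` (at which the four vertices would lie on a
great two-sphere). -/
def AdmissibleEdge (K : SpaceKind) (r a : ℝ) : Prop :=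
  0 < a ∧ (K = .spherical → a < 2 * r * Real.arctan (√2))

/-- `P` lists the vertices of a regular geodesic tetrahedron of edge length `a` in the space of
kind `K` and radius of curvature `r`. -/
structure IsRegularTetrahedron (K : SpaceKind) (r a : ℝ) (P : Fin 4 → Fin 4 → ℝ) : Prop where
  admissible : AdmissibleEdge K r a
  mem : ∀ i, P i ∈ modelSpace K r
  edge : ∀ i j, i ≠ j → simplexMeasure K r (k := 1) ![P i, P j] = a

/-- The volume of the geodesic tetrahedron with vertices `P`. -/
noncomputable def tetraVolume (K : SpaceKind) (r : ℝ) (P : Fin 4 → Fin 4 → ℝ) : ℝ :=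
  simplexMeasure K r (k := 3) P

/-- The area of the face opposite to the vertex `P f`. -/
noncomputable def faceArea (K : SpaceKind) (r : ℝ) (P : Fin 4 → Fin 4 → ℝ) (f : Fin 4) : ℝ :=
  simplexMeasure K r (k := 2) fun i => P (f.succAbove i)

/-- The volume-area ratio, computed with the face opposite to the vertex `P f`. -/
noncomputable def volumeAreaRatio (K : SpaceKind) (r : ℝ) (P : Fin 4 → Fin 4 → ℝ) (f : Fin 4) : ℝ :=
  tetraVolume K r P / faceArea K r P f ^ (3 / 2 : ℝ)

/-- The constant `√2 / (12 (√3/4)^{3/2})`. -/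
noncomputable def euclideanRatio : ℝ := √2 / (12 * (√3 / 4) ^ (3 / 2 : ℝ))

/-! Let `c` be the normalised inner product of two vertices: `cos (a / r)` on the sphere, `cosh (a /
r)` on the hyperboloid. Pulled back to the flat simplex by central projection, the metric depends
only on the quadratic form q = `simplexForm c`, and its density is a constant times q^(-(k+1)/2).
Writing R = r²|1 - c|, the area is A = R √(1+2c) I and the volume V = R^(3/2) √(1+3c) J, where I
integrates q^(-3/2) over the triangle and J integrates q^(-2) over the tetrahedron.

Completing the square (`simplexForm_sub`) shows that q has its extremum at the barycenter, with
value (1+kc)/(k+1): a minimum for c < 1 (sphere), a maximum for c > 1 (hyperboloid). This sign is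
the whole difference between the two geometries.

I and J are linked by the divergence theorem for a radial field centred at the barycenter
(`setIntegral_simplexForm_rpow_neg_five_halves`): 3β ∫ q^(-5/2) = I, with β = (1+3c)/4. Comparing q
with β pointwise gives I < 3√β J on the sphere and the reverse on the hyperboloid. Comparing q on a
face with its value (1+2c)/3 at the centre of that face bounds (1+2c)^(3/2) I by 3√3/2 in the
matching direction. In A³ = R³ I² · (1+2c)^(3/2) I the two bounds combine to compare 8A³ with 27√3
V² (`HasRegularGram.area_cube_lt`, `HasRegularGram.lt_area_cube`), and 8/(27√3) is the square of the
Euclidean ratio. The flat case is a direct computation. -/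

open MeasureTheory

/-! ### Regular Gram matrices and barycentric coordinates. -/

theorem ambientForm_sum_smul {ι : Type*} [Fintype ι] (K : SpaceKind) (P : ι → Fin 4 → ℝ)
    (a b : ι → ℝ) :
    ambientForm K (∑ i, a i • P i) (∑ j, b j • P j) =
      ∑ i, ∑ j, a i * b j * ambientForm K (P i) (P j) := by
  have key : ∀ l, (∑ i, a i * P i l) * ∑ j, b j * P j l =
      ∑ i, ∑ j, a i * b j * (P i l * P j l) := by
    intro l
    rw [Finset.sum_mul_sum]
    exact Finset.sum_congr rfl fun i _ => Finset.sum_congr rfl fun j _ => by ring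
  simp only [ambientForm, Finset.sum_apply, Pi.smul_apply, smul_eq_mul, key, mul_add,
    Finset.sum_add_distrib, Finset.mul_sum, mul_left_comm _ K.epsSq]

/-- The points `P i` have the Gram matrix `ε² r² (c + (1 - c) δᵢⱼ)`. -/
def HasRegularGram {ι : Type*} [DecidableEq ι] (K : SpaceKind) (r c : ℝ) (P : ι → Fin 4 → ℝ) :
    Prop :=
  ∀ i j, ambientForm K (P i) (P j) = K.epsSq * r ^ 2 * (c + (1 - c) * if i = j then 1 else 0)

theorem HasRegularGram.comp {ι κ : Type*} [DecidableEq ι] [DecidableEq κ] {K : SpaceKind}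
    {r c : ℝ} {P : ι → Fin 4 → ℝ} (h : HasRegularGram K r c P) {f : κ → ι}
    (hf : Function.Injective f) : HasRegularGram K r c fun i => P (f i) := by
  intro i j
  rw [h]
  simp [hf.eq_iff]

theorem HasRegularGram.ambientForm_sum {ι : Type*} [Fintype ι] [DecidableEq ι] {K : SpaceKind}
    {r c : ℝ} {P : ι → Fin 4 → ℝ} (h : HasRegularGram K r c P) (a b : ι → ℝ) :
    ambientForm K (∑ i, a i • P i) (∑ j, b j • P j) =
      K.epsSq * r ^ 2 * (c * ((∑ i, a i) * ∑ i, b i) + (1 - c) * ∑ i, a i * b i) := by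
  rw [ambientForm_sum_smul, Finset.sum_mul_sum]
  simp only [h _ _, mul_add, Finset.mul_sum, Finset.sum_add_distrib]
  congr 1
  · refine Finset.sum_congr rfl fun i _ => Finset.sum_congr rfl fun j _ => by ring
  · refine Finset.sum_congr rfl fun i _ => ?_
    rw [Finset.sum_eq_single i]
    · simp; ring
    · intro j _ hj
      simp [hj.symm]
    · simp

/-- The barycentric coordinates of the point of the simplex with coordinates `t`. -/
def baryCoord {k : ℕ} (t : Fin k → ℝ) : Fin (k + 1) → ℝ :=
  Fin.cons (1 - ∑ i, t i) t

theorem sum_baryCoord {k : ℕ} (t : Fin k → ℝ) : ∑ i, baryCoord t i = 1 := by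
  simp [baryCoord, Fin.sum_univ_succ]

/-- The squared norm, up to sign and scale, of the point with coordinates `t` of a flat simplex
whose vertices have a regular Gram matrix. -/
def simplexForm (c : ℝ) {k : ℕ} (t : Fin k → ℝ) : ℝ :=
  c + (1 - c) * ∑ i, baryCoord t i ^ 2

/-- The direction of the edge from the vertex `0` to the vertex `i + 1`, in barycentric
coordinates. -/
def edgeWeight {k : ℕ} (i : Fin k) : Fin (k + 1) → ℝ :=
  Fin.cons (-1) (Pi.single i 1)

theorem sum_edgeWeight {k : ℕ} (i : Fin k) : ∑ j, edgeWeight i j = 0 := by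
  simp [edgeWeight, Fin.sum_univ_succ]

theorem sum_baryCoord_mul_edgeWeight {k : ℕ} (t : Fin k → ℝ) (i : Fin k) :
    ∑ j, baryCoord t j * edgeWeight i j = t i - (1 - ∑ i, t i) := by
  simp [baryCoord, edgeWeight, Fin.sum_univ_succ, Pi.single_apply]
  ring

theorem sum_edgeWeight_mul_edgeWeight {k : ℕ} (i j : Fin k) :
    ∑ l, edgeWeight i l * edgeWeight j l = 1 + if i = j then 1 else 0 := by
  simp [edgeWeight, Fin.sum_univ_succ, Pi.single_apply, eq_comm]

theorem sum_baryCoord_smul {k : ℕ} (P : Fin (k + 1) → Fin 4 → ℝ) (t : Fin k → ℝ) :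
    (1 - ∑ i, t i) • P 0 + ∑ i, t i • P i.succ = ∑ i, baryCoord t i • P i := by
  simp [baryCoord, Fin.sum_univ_succ]

theorem sum_edgeWeight_smul {k : ℕ} (P : Fin (k + 1) → Fin 4 → ℝ) (i : Fin k) :
    ∑ j, edgeWeight i j • P j = P i.succ - P 0 := by
  simp [edgeWeight, Fin.sum_univ_succ, Pi.single_apply]
  abel

theorem sum_baryCoord_add_single {k : ℕ} (P : Fin (k + 1) → Fin 4 → ℝ) (t : Fin k → ℝ)
    (i : Fin k) (s : ℝ) :
    ∑ j, baryCoord (t + s • Pi.single i 1) j • P j =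
      (∑ j, baryCoord t j • P j) + s • ∑ j, edgeWeight i j • P j := by
  rw [Finset.smul_sum, ← Finset.sum_add_distrib]
  refine Finset.sum_congr rfl fun j _ => ?_
  rw [smul_smul, ← add_smul]
  congr 1
  refine Fin.cases ?_ (fun j => ?_) j
  · simp [baryCoord, edgeWeight, Finset.sum_add_distrib, ← Finset.mul_sum]
    ring
  · simp [baryCoord, edgeWeight]

/-! ### Differential of the central projection and the induced metric. -/

theorem ambientForm_add_smul (K : SpaceKind) (X V : Fin 4 → ℝ) (s : ℝ) :
    ambientForm K (X + s • V) (X + s • V) =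
      ambientForm K X X + s * (2 * ambientForm K X V) + s ^ 2 * ambientForm K V V := by
  simp [ambientForm]
  ring

theorem ambientForm_smul_smul (K : SpaceKind) (a b : ℝ) (X Y : Fin 4 → ℝ) :
    ambientForm K (a • X) (b • Y) = a * b * ambientForm K X Y := by
  simp [ambientForm]
  ring

theorem ambientForm_sub_smul (K : SpaceKind) (X V W : Fin 4 → ℝ) (a b : ℝ) :
    ambientForm K (V - a • X) (W - b • X) = ambientForm K V W - b * ambientForm K X V
      - a * ambientForm K X W + a * b * ambientForm K X X := by
  simp [ambientForm]
  ring

/-- Radial projection forgets the component of `V` along `X`, so only the tangential part survives,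
rescaled. The absolute value makes one formula serve both signatures. -/
theorem hasDerivAt_radial (K : SpaceKind) (r : ℝ) (X V : Fin 4 → ℝ)
    (h : ambientForm K X X ≠ 0) :
    HasDerivAt (fun s : ℝ => (r / √|ambientForm K (X + s • V) (X + s • V)|) • (X + s • V))
      ((r / √|ambientForm K X X|) • (V - (ambientForm K X V / ambientForm K X X) • X)) 0 := by
  have h1 : HasDerivAt (fun s : ℝ => ambientForm K (X + s • V) (X + s • V))
      (2 * ambientForm K X V) 0 := by
    simp_rw [ambientForm_add_smul]
    have := (((hasDerivAt_id (0 : ℝ)).mul_const (2 * ambientForm K X V)).const_add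
      (ambientForm K X X)).add ((hasDerivAt_pow 2 (0 : ℝ)).mul_const (ambientForm K V V))
    exact this.congr_deriv (by simp)
  have h0 : ambientForm K (X + (0 : ℝ) • V) (X + (0 : ℝ) • V) = ambientForm K X X := by simp
  have h1' := (hasDerivAt_abs (by rwa [h0])).comp (0 : ℝ) h1
  have h2 := (h1'.sqrt (by rw [Function.comp_apply, h0]; simpa using h)).fun_inv
    (by rw [Function.comp_apply, h0]; exact (Real.sqrt_pos.2 (abs_pos.2 h)).ne')
  have h3 : HasDerivAt (fun s : ℝ => X + s • V) V 0 := by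
    simpa using ((hasDerivAt_id (0 : ℝ)).smul_const V).const_add X
  have h4 := (h2.const_mul r).smul h3
  simp only [Function.comp_apply, zero_smul, add_zero] at h4
  refine h4.congr_deriv ?_
  have hs := Real.sq_sqrt (abs_nonneg (ambientForm K X X))
  have hp := (Real.sqrt_pos.2 (abs_pos.2 h))
  set q := ambientForm K X X
  set n := √|q|
  have hsg : (SignType.sign q : ℝ) * q = n ^ 2 := by rw [hs]; exact sign_mul_self q
  rw [smul_sub, smul_smul, sub_eq_add_neg, ← neg_smul]
  congr 2
  have hn : n ≠ 0 := hp.ne'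
  field_simp
  rw [← hsg]
  ring

theorem fderiv_geodesicSimplex {K : SpaceKind} (hK : K ≠ .euclidean) (r : ℝ) {k : ℕ}
    (P : Fin (k + 1) → Fin 4 → ℝ) (t : Fin k → ℝ) (i : Fin k)
    (h : ambientForm K (∑ i, baryCoord t i • P i) (∑ i, baryCoord t i • P i) ≠ 0) :
    fderiv ℝ (geodesicSimplex K r P) t (Pi.single i 1) =
      (r / √|ambientForm K (∑ i, baryCoord t i • P i) (∑ i, baryCoord t i • P i)|) •
        (∑ j, edgeWeight i j • P j - (ambientForm K (∑ i, baryCoord t i • P i)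
          (∑ j, edgeWeight i j • P j) / ambientForm K (∑ i, baryCoord t i • P i)
            (∑ i, baryCoord t i • P i)) • ∑ i, baryCoord t i • P i) := by
  have hg : geodesicSimplex K r P = fun t =>
      (r / √|ambientForm K (∑ i, baryCoord t i • P i) (∑ i, baryCoord t i • P i)|) •
        ∑ i, baryCoord t i • P i := by
    funext t
    rw [geodesicSimplex, sum_baryCoord_smul]
    cases K
    · rfl
    · exact absurd rfl hK
    · rfl
  have hb : ∀ j, DifferentiableAt ℝ (fun t : Fin k → ℝ => baryCoord t j) t := by
    intro j
    refine Fin.cases ?_ (fun j => ?_) j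
    · simp only [baryCoord, Fin.cons_zero]
      fun_prop
    · simp only [baryCoord, Fin.cons_succ]
      fun_prop
  have hX : DifferentiableAt ℝ (fun t : Fin k → ℝ => ∑ i, baryCoord t i • P i) t := by
    refine DifferentiableAt.fun_sum fun j _ => ?_
    exact (hb j).smul_const _
  have hQ : DifferentiableAt ℝ (fun t : Fin k → ℝ =>
      ambientForm K (∑ i, baryCoord t i • P i) (∑ i, baryCoord t i • P i)) t := by
    have := fun j => (differentiableAt_pi.1 hX j)
    simp only [ambientForm]
    exact (((this 0).mul (this 0)).add ((this 1).mul (this 1))).add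
      ((this 2).mul (this 2)) |>.add (((this 3).mul (this 3)).const_mul _)
  have hd : DifferentiableAt ℝ (geodesicSimplex K r P) t := by
    rw [hg]
    exact (((hQ.abs h).sqrt (abs_pos.2 h).ne').inv
      (Real.sqrt_pos.2 (abs_pos.2 h)).ne').const_mul r |>.smul hX
  -- Along a coordinate line the barycentric combination moves affinely, with velocity an edge
  -- vector, so the radial derivative applies.
  rw [← hd.lineDeriv_eq_fderiv, lineDeriv, hg]
  simp only [sum_baryCoord_add_single]
  exact (hasDerivAt_radial K r _ _ h).deriv

theorem epsSq_mul_self (K : SpaceKind) : K.epsSq * K.epsSq = 1 := by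
  cases K <;> simp [SpaceKind.epsSq]

theorem abs_epsSq (K : SpaceKind) : |K.epsSq| = 1 := by
  cases K <;> simp [SpaceKind.epsSq]

theorem HasRegularGram.ambientForm_baryCoord {K : SpaceKind} {r c : ℝ} {k : ℕ}
    {P : Fin (k + 1) → Fin 4 → ℝ} (h : HasRegularGram K r c P) (t : Fin k → ℝ) :
    ambientForm K (∑ i, baryCoord t i • P i) (∑ i, baryCoord t i • P i) =
      K.epsSq * r ^ 2 * simplexForm c t := by
  rw [h.ambientForm_sum, sum_baryCoord, simplexForm]
  simp [sq]

/-- Edge vectors have weights summing to zero, so the constant part of the Gram matrix drops out of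
their products and a factor `1 - c` remains. The subtracted rank-one term comes from the tangential
projection. -/
theorem HasRegularGram.inducedMetric_apply {K : SpaceKind} (hK : K ≠ .euclidean) {r c : ℝ}
    (hr : 0 < r) {k : ℕ} {P : Fin (k + 1) → Fin 4 → ℝ} (h : HasRegularGram K r c P)
    (t : Fin k → ℝ) (hq : 0 < simplexForm c t) (i j : Fin k) :
    inducedMetric K r P t i j = K.epsSq * r ^ 2 * (1 - c) / simplexForm c t *
      ((1 + if i = j then 1 else 0) - (1 - c) * (t i - (1 - ∑ i, t i)) *
        (t j - (1 - ∑ i, t i)) / simplexForm c t) := by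
  have he : K.epsSq ≠ 0 := fun h0 => by simpa [h0] using epsSq_mul_self K
  have h0 : ambientForm K (∑ i, baryCoord t i • P i) (∑ i, baryCoord t i • P i) ≠ 0 := by
    rw [h.ambientForm_baryCoord]
    positivity
  simp only [inducedMetric, Matrix.of_apply]
  rw [fderiv_geodesicSimplex hK r P t i h0, fderiv_geodesicSimplex hK r P t j h0,
    ambientForm_smul_smul, ambientForm_sub_smul, div_mul_div_comm,
    Real.mul_self_sqrt (abs_nonneg _), h.ambientForm_baryCoord]
  simp only [h.ambientForm_sum, sum_baryCoord, sum_edgeWeight, sum_baryCoord_mul_edgeWeight,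
    sum_edgeWeight_mul_edgeWeight]
  rw [abs_mul, abs_mul, abs_epsSq, abs_of_pos hq, abs_of_pos (by positivity : 0 < r ^ 2)]
  field_simp
  ring

/-- For a `k`-simplex, (1-c)^k (1+kc) is the determinant of the normalised Gram matrix (eigenvalue
1-c with multiplicity k, and 1+kc); the power q^(k+1) comes from the projection. The cases k = 1, 2,
3 are expanded explicitly. -/
theorem abs_det_inducedMetric_one {K : SpaceKind} (hK : K ≠ .euclidean) {r c : ℝ} (hr : 0 < r)
    {P : Fin 2 → Fin 4 → ℝ} (h : HasRegularGram K r c P) (hc : 0 ≤ 1 + c)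
    (t : Fin 1 → ℝ) (hq : 0 < simplexForm c t) :
    |(inducedMetric K r P t).det| = r ^ 2 * |1 - c| * (1 + c) / simplexForm c t ^ 2 := by
  have hd : (inducedMetric K r P t).det =
      K.epsSq * (r ^ 2 * (1 - c) * (1 + c) / simplexForm c t ^ 2) := by
    rw [Matrix.det_fin_one, h.inducedMetric_apply hK hr t hq]
    field_simp
    simp [simplexForm, baryCoord, Fin.sum_univ_succ]
    exact Or.inl (by ring)
  rw [hd, abs_mul, abs_epsSq, one_mul, abs_div, abs_mul, abs_mul, abs_of_nonneg hc,
    abs_of_nonneg (sq_nonneg r), abs_of_pos (by positivity : 0 < simplexForm c t ^ 2)]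

theorem abs_det_inducedMetric_two {K : SpaceKind} (hK : K ≠ .euclidean) {r c : ℝ} (hr : 0 < r)
    {P : Fin 3 → Fin 4 → ℝ} (h : HasRegularGram K r c P) (hc : 0 ≤ 1 + 2 * c)
    (t : Fin 2 → ℝ) (hq : 0 < simplexForm c t) :
    |(inducedMetric K r P t).det| =
      (r ^ 2 * |1 - c|) ^ 2 * (1 + 2 * c) / simplexForm c t ^ 3 := by
  have hd : (inducedMetric K r P t).det =
      K.epsSq * K.epsSq * ((r ^ 2 * (1 - c)) ^ 2 * (1 + 2 * c) / simplexForm c t ^ 3) := by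
    rw [Matrix.det_fin_two]
    simp only [h.inducedMetric_apply hK hr t hq]
    field_simp
    simp [simplexForm, baryCoord, Fin.sum_univ_succ]
    ring
  rw [hd, epsSq_mul_self, one_mul, abs_div, abs_mul, abs_pow, abs_mul, abs_of_nonneg hc,
    abs_of_nonneg (sq_nonneg r), abs_of_pos (by positivity : 0 < simplexForm c t ^ 3)]

theorem abs_det_inducedMetric_three {K : SpaceKind} (hK : K ≠ .euclidean) {r c : ℝ} (hr : 0 < r)
    {P : Fin 4 → Fin 4 → ℝ} (h : HasRegularGram K r c P) (hc : 0 ≤ 1 + 3 * c)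
    (t : Fin 3 → ℝ) (hq : 0 < simplexForm c t) :
    |(inducedMetric K r P t).det| =
      (r ^ 2 * |1 - c|) ^ 3 * (1 + 3 * c) / simplexForm c t ^ 4 := by
  have hd : (inducedMetric K r P t).det =
      K.epsSq ^ 3 * ((r ^ 2 * (1 - c)) ^ 3 * (1 + 3 * c) / simplexForm c t ^ 4) := by
    rw [Matrix.det_fin_three]
    simp only [h.inducedMetric_apply hK hr t hq]
    field_simp
    simp [simplexForm, baryCoord, Fin.sum_univ_succ]
    ring
  rw [hd, abs_mul, abs_pow, abs_epsSq, one_pow, one_mul, abs_div, abs_mul, abs_pow, abs_mul,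
    abs_of_nonneg hc, abs_of_nonneg (sq_nonneg r),
    abs_of_pos (by positivity : 0 < simplexForm c t ^ 4)]

/-! ### Integration over the corner simplex. -/

theorem isCompact_cornerSimplex (k : ℕ) : IsCompact (cornerSimplex k) := by
  have h : cornerSimplex k ⊆ Set.Icc 0 1 := fun t ht =>
    ⟨fun i => ht.1 i, fun i => (Finset.single_le_sum (fun j _ => ht.1 j) (Finset.mem_univ i)).trans
      ht.2⟩
  refine (isCompact_Icc).of_isClosed_subset ?_ h
  have : cornerSimplex k = (⋂ i, {t : Fin k → ℝ | 0 ≤ t i}) ∩ {t | ∑ i, t i ≤ 1} := by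
    ext t
    simp [cornerSimplex]
  rw [this]
  refine (isClosed_iInter fun i => isClosed_le (by fun_prop) (by fun_prop)).inter
    (isClosed_le (by fun_prop) (by fun_prop))

theorem measurableSet_cornerSimplex (k : ℕ) : MeasurableSet (cornerSimplex k) :=
  (isCompact_cornerSimplex k).isClosed.measurableSet

theorem cons_mem_cornerSimplex {k : ℕ} {x : ℝ} {u : Fin k → ℝ} :
    (Fin.cons x u : Fin (k + 1) → ℝ) ∈ cornerSimplex (k + 1) ↔
      u ∈ cornerSimplex k ∧ x ∈ Set.Icc 0 (1 - ∑ i, u i) := by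
  simp only [cornerSimplex, Set.mem_ofPred_eq, Fin.forall_fin_succ, Fin.cons_zero, Fin.cons_succ,
    Fin.sum_univ_succ, Set.mem_Icc]
  constructor
  · rintro ⟨⟨h0, h1⟩, h2⟩
    exact ⟨⟨h1, by linarith⟩, h0, by linarith⟩
  · rintro ⟨⟨h1, h2⟩, h0, h3⟩
    exact ⟨⟨h0, h1⟩, by linarith⟩

/-- Fubini with the first coordinate innermost: the fibre over `u` is the interval from `0` to `1 -
∑ i, u i`. -/
theorem setIntegral_cornerSimplex_succ {k : ℕ} {g : (Fin (k + 1) → ℝ) → ℝ}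
    (hg : ContinuousOn g (cornerSimplex (k + 1))) :
    ∫ t in cornerSimplex (k + 1), g t =
      ∫ u in cornerSimplex k, ∫ x in (0 : ℝ)..(1 - ∑ i, u i), g (Fin.cons x u) := by
  have hmp := (volume_preserving_piFinSuccAbove (fun _ : Fin (k + 1) => ℝ) 0).symm
  have hi : Integrable ((cornerSimplex (k + 1)).indicator g) :=
    (hg.integrableOn_compact (isCompact_cornerSimplex _)).integrable_indicator
      (measurableSet_cornerSimplex _)
  have hi' : Integrable (fun p : ℝ × (Fin k → ℝ) => (cornerSimplex (k + 1)).indicator g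
      ((MeasurableEquiv.piFinSuccAbove (fun _ : Fin (k + 1) => ℝ) 0).symm p))
      (volume.prod volume) := hmp.integrable_comp_of_integrable hi
  rw [← integral_indicator (measurableSet_cornerSimplex _),
    ← hmp.integral_comp (MeasurableEquiv.measurableEmbedding _), Measure.volume_eq_prod,
    integral_prod_symm _ hi',
    ← integral_indicator (measurableSet_cornerSimplex _)]
  refine integral_congr_ae (Filter.Eventually.of_forall fun u => ?_)
  have he : ∀ x : ℝ, (MeasurableEquiv.piFinSuccAbove (fun _ : Fin (k + 1) => ℝ) 0).symm (x, u) =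
      Fin.cons x u := fun x => by
    simp [MeasurableEquiv.piFinSuccAbove, Fin.insertNthEquiv]
  simp only [he]
  by_cases hu : u ∈ cornerSimplex k
  · have h01 : (0 : ℝ) ≤ 1 - ∑ i, u i := by linarith [hu.2]
    rw [Set.indicator_of_mem hu, intervalIntegral.integral_of_le h01,
      ← integral_Icc_eq_integral_Ioc, ← integral_indicator measurableSet_Icc]
    congr 1
    funext x
    by_cases hx : x ∈ Set.Icc 0 (1 - ∑ i, u i)
    · rw [Set.indicator_of_mem hx, Set.indicator_of_mem (cons_mem_cornerSimplex.2 ⟨hu, hx⟩)]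
    · rw [Set.indicator_of_notMem hx,
        Set.indicator_of_notMem fun h => hx (cons_mem_cornerSimplex.1 h).2]
  · rw [Set.indicator_of_notMem hu]
    have : ∀ x : ℝ, (cornerSimplex (k + 1)).indicator g (Fin.cons x u) = 0 := fun x =>
      Set.indicator_of_notMem (fun h => hu (cons_mem_cornerSimplex.1 h).1) _
    simp [this]

theorem setIntegral_cornerSimplex_zero (g : (Fin 0 → ℝ) → ℝ) :
    ∫ t in cornerSimplex 0, g t = g 0 := by
  have h : cornerSimplex 0 = Set.univ := by
    ext t
    simp [cornerSimplex]
  rw [h, Measure.restrict_univ, Measure.volume_pi_eq_dirac (0 : Fin 0 → ℝ), integral_dirac]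

theorem setIntegral_cornerSimplex_one {g : (Fin 1 → ℝ) → ℝ}
    (hg : ContinuousOn g (cornerSimplex 1)) :
    ∫ t in cornerSimplex 1, g t = ∫ x in (0 : ℝ)..1, g fun _ => x := by
  rw [setIntegral_cornerSimplex_succ hg, setIntegral_cornerSimplex_zero]
  simp only [Finset.univ_eq_empty, Finset.sum_empty, sub_zero]
  congr 1
  funext x
  congr 1
  funext i
  fin_cases i
  rfl

theorem setIntegral_cornerSimplex_one_one : ∫ _ in cornerSimplex 1, (1 : ℝ) = 1 := by
  rw [setIntegral_cornerSimplex_one continuousOn_const]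
  simp

theorem setIntegral_cornerSimplex_two_one : ∫ _ in cornerSimplex 2, (1 : ℝ) = 1 / 2 := by
  rw [setIntegral_cornerSimplex_succ continuousOn_const]
  simp only [intervalIntegral.integral_const, sub_zero, smul_eq_mul, mul_one]
  rw [setIntegral_cornerSimplex_one (by fun_prop)]
  have := intervalIntegral.integral_comp_sub_left (a := 0) (b := 1) (fun x : ℝ => x) 1
  simpa using this

theorem setIntegral_cornerSimplex_three_one : ∫ _ in cornerSimplex 3, (1 : ℝ) = 1 / 6 := by
  rw [setIntegral_cornerSimplex_succ continuousOn_const]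
  simp only [intervalIntegral.integral_const, sub_zero, smul_eq_mul, mul_one]
  rw [setIntegral_cornerSimplex_succ (by fun_prop)]
  simp only [Fin.sum_univ_succ, Fin.cons_zero, Fin.cons_succ, Finset.univ_eq_empty,
    Finset.sum_empty, add_zero]
  have : ∀ b : ℝ, ∫ x in (0 : ℝ)..(1 - b), (1 - (x + b)) = (1 - b) ^ 2 / 2 := by
    intro b
    have h : (fun x : ℝ => 1 - (x + b)) = fun x => (1 - b) - x := by funext x; ring
    rw [h, intervalIntegral.integral_sub (by simp) (by simp)]
    simp
    ring
  simp only [this]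
  rw [setIntegral_cornerSimplex_one (by fun_prop)]
  rw [intervalIntegral.integral_div]
  rw [intervalIntegral.integral_comp_sub_left (fun x : ℝ => x ^ 2) 1]
  simp
  norm_num

/-- The substitution swaps the barycentric coordinates `0` and `1`; on each slice it is the
reflection of an interval. Together with permutations of the `t i` it generates the full symmetry
group of the simplex. -/
theorem setIntegral_cornerSimplex_reflect {k : ℕ} {g : (Fin (k + 1) → ℝ) → ℝ}
    (hg : ContinuousOn g (cornerSimplex (k + 1))) :
    ∫ t in cornerSimplex (k + 1), g (Fin.cons (1 - ∑ i, t i) (Fin.tail t)) =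
      ∫ t in cornerSimplex (k + 1), g t := by
  have hm : Set.MapsTo (fun t : Fin (k + 1) → ℝ =>
      (Fin.cons (1 - ∑ i, t i) (Fin.tail t) : Fin (k + 1) → ℝ))
      (cornerSimplex (k + 1)) (cornerSimplex (k + 1)) := by
    intro t ht
    rw [← Fin.cons_self_tail t, cons_mem_cornerSimplex] at ht
    have h0 := ht.2.1
    have h1 := ht.2.2
    refine cons_mem_cornerSimplex.2 ⟨ht.1, ?_⟩
    simp only [Fin.sum_univ_succ, Fin.tail, Set.mem_Icc] at h1 ⊢
    constructor <;> linarith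
  have hc : Continuous (fun t : Fin (k + 1) → ℝ =>
      (Fin.cons (1 - ∑ i, t i) (Fin.tail t) : Fin (k + 1) → ℝ)) := by
    refine continuous_pi fun i => ?_
    refine Fin.cases ?_ (fun i => ?_) i
    · simp only [Fin.cons_zero]
      fun_prop
    · simp only [Fin.cons_succ, Fin.tail]
      fun_prop
  have hgc : ContinuousOn (fun t : Fin (k + 1) → ℝ =>
      g (Fin.cons (1 - ∑ i, t i) (Fin.tail t))) (cornerSimplex (k + 1)) :=
    hg.comp hc.continuousOn hm
  rw [setIntegral_cornerSimplex_succ hg, setIntegral_cornerSimplex_succ hgc]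
  congr 1
  funext u
  simp only [Fin.tail_cons, Fin.sum_univ_succ, Fin.cons_zero, Fin.cons_succ]
  have := intervalIntegral.integral_comp_sub_left (a := 0) (b := 1 - ∑ i, u i)
    (fun x : ℝ => g (Fin.cons x u)) (1 - ∑ i, u i)
  rw [sub_self, sub_zero] at this
  rw [← this]
  congr 1
  funext x
  congr 2
  ring

theorem setIntegral_cornerSimplex_perm {k : ℕ} (g : (Fin k → ℝ) → ℝ) (e : Equiv.Perm (Fin k)) :
    ∫ t in cornerSimplex k, g (fun i => t (e i)) = ∫ t in cornerSimplex k, g t := by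
  have h := volume_measurePreserving_piCongrLeft (fun _ : Fin k => ℝ) e.symm
  have he : ∀ t : Fin k → ℝ, MeasurableEquiv.piCongrLeft (fun _ : Fin k => ℝ) e.symm t =
      fun i => t (e i) := by
    intro t
    funext i
    have := MeasurableEquiv.piCongrLeft_apply_apply e.symm (β := fun _ => ℝ) t (e i)
    simpa using this
  have hp : (MeasurableEquiv.piCongrLeft (fun _ : Fin k => ℝ) e.symm) ⁻¹' cornerSimplex k =
      cornerSimplex k := by
    ext t
    simp only [Set.mem_preimage, he, cornerSimplex, Set.mem_ofPred_eq, Equiv.sum_comp e t]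
    exact and_congr_left fun _ => ⟨fun h i => by simpa using h (e.symm i), fun h i => h _⟩
  have := h.setIntegral_preimage_emb (MeasurableEquiv.measurableEmbedding _) g (cornerSimplex k)
  rw [hp] at this
  simpa only [he] using this

/-- The exceptional point `b` will be the barycenter, the one point where the integrands compared
below agree. -/
theorem setIntegral_lt_setIntegral_cornerSimplex {k : ℕ} (hk : volume (cornerSimplex k) ≠ 0)
    {f g : (Fin k → ℝ) → ℝ}
    (hf : ContinuousOn f (cornerSimplex k)) (hg : ContinuousOn g (cornerSimplex k))
    (b : Fin k → ℝ) (hb : volume {b} = 0) (h : ∀ t ∈ cornerSimplex k, t ≠ b → f t < g t) :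
    ∫ t in cornerSimplex k, f t < ∫ t in cornerSimplex k, g t := by
  have hfi := hf.integrableOn_compact (μ := volume) (isCompact_cornerSimplex k)
  have hgi := hg.integrableOn_compact (μ := volume) (isCompact_cornerSimplex k)
  have hae : ∀ᵐ t ∂(volume.restrict (cornerSimplex k)), f t < g t := by
    have h1 : ∀ᵐ t ∂(volume : Measure (Fin k → ℝ)), t ≠ b := by
      rw [ae_iff]
      simpa using hb
    filter_upwards [ae_restrict_mem (measurableSet_cornerSimplex k), ae_restrict_of_ae h1]
      with t ht htb using h t ht htb
  rw [← sub_pos, ← integral_sub hgi hfi, integral_pos_iff_support_of_nonneg_ae]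
  · rw [pos_iff_ne_zero]
    intro h0
    have : ∀ᵐ t ∂(volume.restrict (cornerSimplex k)), g t - f t = 0 := by
      rw [ae_iff]
      exact h0
    have hF : ∀ᵐ t ∂(volume.restrict (cornerSimplex k)), False := by
      filter_upwards [hae, this] with t h1 h2
      linarith
    rw [Filter.eventually_false_iff_eq_bot, ae_eq_bot, Measure.restrict_eq_zero] at hF
    exact hk hF
  · filter_upwards [hae] with t ht
    exact (sub_pos.2 ht).le
  · exact hgi.sub hfi

/-! ### The quadratic form: extremum at the barycenter, positivity. -/

theorem simplexForm_eq (c : ℝ) {k : ℕ} (t : Fin k → ℝ) :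
    simplexForm c t = c + (1 - c) * ((1 - ∑ i, t i) ^ 2 + ∑ i, t i ^ 2) := by
  simp [simplexForm, baryCoord, Fin.sum_univ_succ]

theorem simplexForm_perm (c : ℝ) {k : ℕ} (t : Fin k → ℝ) (e : Equiv.Perm (Fin k)) :
    simplexForm c (fun i => t (e i)) = simplexForm c t := by
  rw [simplexForm_eq, simplexForm_eq, Equiv.sum_comp e t, Equiv.sum_comp e fun i => t i ^ 2]

theorem simplexForm_cons (c : ℝ) {k : ℕ} (x : ℝ) (u : Fin k → ℝ) :
    simplexForm c (Fin.cons x u : Fin (k + 1) → ℝ) =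
      c + (1 - c) * ((1 - (x + ∑ i, u i)) ^ 2 + (x ^ 2 + ∑ i, u i ^ 2)) := by
  simp [simplexForm_eq, Fin.sum_univ_succ]

theorem continuous_simplexForm (c : ℝ) (k : ℕ) :
    Continuous (simplexForm c : (Fin k → ℝ) → ℝ) := by
  have : (simplexForm c : (Fin k → ℝ) → ℝ) = _ := funext fun t => simplexForm_eq c t
  rw [this]
  fun_prop

/-- Completing the square on the hyperplane where the coordinates sum to 1. The sign of `1 - c`
makes the barycentric value a minimum or a maximum, which separates spherical from hyperbolic
geometry. -/
theorem simplexForm_sub (c : ℝ) {k : ℕ} (t : Fin k → ℝ) :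
    simplexForm c t - (1 + k * c) / (k + 1) =
      (1 - c) * ∑ i, (baryCoord t i - 1 / (k + 1)) ^ 2 := by
  have h : ∀ i, (baryCoord t i - 1 / ((k : ℝ) + 1)) ^ 2 =
      baryCoord t i ^ 2 - 2 / ((k : ℝ) + 1) * baryCoord t i + (1 / ((k : ℝ) + 1)) ^ 2 := fun i => by
    ring
  simp only [h, Finset.sum_add_distrib, Finset.sum_sub_distrib, ← Finset.mul_sum, sum_baryCoord,
    simplexForm]
  have : (k : ℝ) + 1 ≠ 0 := by positivity
  simp
  field_simp
  ring

theorem le_simplexForm {c : ℝ} (hc : c ≤ 1) {k : ℕ} (t : Fin k → ℝ) :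
    (1 + k * c) / (k + 1) ≤ simplexForm c t := by
  have := mul_nonneg (sub_nonneg.2 hc)
    (Finset.sum_nonneg fun i (_ : i ∈ Finset.univ) => sq_nonneg (baryCoord t i - 1 / ((k : ℝ) + 1)))
  linarith [simplexForm_sub c t]

theorem simplexForm_le {c : ℝ} (hc : 1 ≤ c) {k : ℕ} (t : Fin k → ℝ) :
    simplexForm c t ≤ (1 + k * c) / (k + 1) := by
  have := mul_nonneg (sub_nonneg.2 hc)
    (Finset.sum_nonneg fun i (_ : i ∈ Finset.univ) => sq_nonneg (baryCoord t i - 1 / ((k : ℝ) + 1)))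
  linarith [simplexForm_sub c t]

theorem sum_sq_sub_barycenter_pos {k : ℕ} {t : Fin k → ℝ} (ht : t ≠ fun _ => 1 / ((k : ℝ) + 1)) :
    0 < ∑ i, (baryCoord t i - 1 / ((k : ℝ) + 1)) ^ 2 := by
  obtain ⟨i, hi⟩ := Function.ne_iff.1 ht
  refine Finset.sum_pos' (fun i _ => sq_nonneg _) ⟨i.succ, Finset.mem_univ _, ?_⟩
  have : baryCoord t i.succ - 1 / ((k : ℝ) + 1) ≠ 0 := by
    simpa [baryCoord, sub_eq_zero] using hi
  positivity

theorem lt_simplexForm {c : ℝ} (hc : c < 1) {k : ℕ} {t : Fin k → ℝ}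
    (ht : t ≠ fun _ => 1 / ((k : ℝ) + 1)) : (1 + k * c) / (k + 1) < simplexForm c t := by
  have := mul_pos (sub_pos.2 hc) (sum_sq_sub_barycenter_pos ht)
  linarith [simplexForm_sub c t]

theorem simplexForm_lt {c : ℝ} (hc : 1 < c) {k : ℕ} {t : Fin k → ℝ}
    (ht : t ≠ fun _ => 1 / ((k : ℝ) + 1)) : simplexForm c t < (1 + k * c) / (k + 1) := by
  have := mul_pos (sub_pos.2 hc) (sum_sq_sub_barycenter_pos ht)
  linarith [simplexForm_sub c t]

theorem sum_baryCoord_sq_le_one {k : ℕ} {t : Fin k → ℝ} (ht : t ∈ cornerSimplex k) :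
    ∑ i, baryCoord t i ^ 2 ≤ 1 := by
  have h0 : ∀ i, 0 ≤ baryCoord t i := by
    intro i
    refine Fin.cases ?_ (fun i => ?_) i
    · simpa [baryCoord] using ht.2
    · simpa [baryCoord] using ht.1 i
  have := Finset.sum_sq_le_sq_sum_of_nonneg (s := Finset.univ) fun i _ => h0 i
  rwa [sum_baryCoord, one_pow] at this

theorem simplexForm_pos {c : ℝ} {k : ℕ} (hc : 0 < 1 + k * c) {t : Fin k → ℝ}
    (ht : t ∈ cornerSimplex k) : 0 < simplexForm c t := by
  rcases le_total c 1 with h | h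
  · exact lt_of_lt_of_le (by positivity) (le_simplexForm h t)
  · have := sum_baryCoord_sq_le_one ht
    -- For `1 ≤ c` the form is smallest at the vertices, where it equals 1.
    rw [simplexForm]
    nlinarith

theorem continuousOn_simplexForm_rpow {c : ℝ} {k : ℕ} (hc : 0 < 1 + k * c) (p : ℝ) :
    ContinuousOn (fun t : Fin k → ℝ => simplexForm c t ^ p) (cornerSimplex k) :=
  (continuous_simplexForm c k).continuousOn.rpow_const fun _ ht =>
    Or.inl (simplexForm_pos hc ht).ne'

theorem integrableOn_cornerSimplex {k : ℕ} {g : (Fin k → ℝ) → ℝ}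
    (hg : ContinuousOn g (cornerSimplex k)) : IntegrableOn g (cornerSimplex k) :=
  hg.integrableOn_compact (isCompact_cornerSimplex k)

/-! ### The divergence identity between triangle and tetrahedron integrals. -/

/-- By symmetry the three barycentric coordinates have equal integrals against the symmetric weight,
and they add up to 1. -/
theorem setIntegral_one_sub_sum_mul {c : ℝ} (hc : 0 < 1 + 2 * c) :
    3 * ∫ t in cornerSimplex 2, (1 - ∑ i, t i) * simplexForm c t ^ (-3 / 2 : ℝ) =
      ∫ t in cornerSimplex 2, simplexForm c t ^ (-3 / 2 : ℝ) := by
  have hf : ContinuousOn (fun t : Fin 2 → ℝ => simplexForm c t ^ (-3 / 2 : ℝ)) (cornerSimplex 2) :=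
    continuousOn_simplexForm_rpow (by exact_mod_cast hc) _
  have hg : ∀ i, ContinuousOn (fun t : Fin 2 → ℝ => t i * simplexForm c t ^ (-3 / 2 : ℝ))
      (cornerSimplex 2) := fun i => (continuous_apply i).continuousOn.mul hf
  have hg' : ContinuousOn (fun t : Fin 2 → ℝ => (1 - ∑ i, t i) * simplexForm c t ^ (-3 / 2 : ℝ))
      (cornerSimplex 2) := ContinuousOn.mul (by fun_prop) hf
  have h0 := setIntegral_cornerSimplex_reflect (hg 0)
  have hq : ∀ t : Fin 2 → ℝ, simplexForm c
      (Fin.cons (1 - ∑ i, t i) (Fin.tail t) : Fin 2 → ℝ) = simplexForm c t := by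
    intro t
    have e : Fin.tail t 0 = t 1 := rfl
    rw [simplexForm_cons, simplexForm_eq]
    simp only [Fin.sum_univ_two, Fin.sum_univ_one, e]
    ring
  simp only [hq, Fin.cons_zero] at h0
  have h1 := setIntegral_cornerSimplex_perm
    (fun t : Fin 2 → ℝ => t 0 * simplexForm c t ^ (-3 / 2 : ℝ)) (Equiv.swap 0 1)
  simp only [simplexForm_perm, Equiv.swap_apply_left] at h1
  have h01 : IntegrableOn (fun t : Fin 2 → ℝ => (1 - ∑ i, t i) * simplexForm c t ^ (-3 / 2 : ℝ) +
      t 0 * simplexForm c t ^ (-3 / 2 : ℝ)) (cornerSimplex 2) :=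
    (integrableOn_cornerSimplex hg').add (integrableOn_cornerSimplex (hg 0))
  have h2 : ∫ t in cornerSimplex 2, simplexForm c t ^ (-3 / 2 : ℝ) =
      ∫ t in cornerSimplex 2, ((1 - ∑ i, t i) * simplexForm c t ^ (-3 / 2 : ℝ) +
        t 0 * simplexForm c t ^ (-3 / 2 : ℝ) + t 1 * simplexForm c t ^ (-3 / 2 : ℝ)) := by
    congr 1
    funext t
    rw [Fin.sum_univ_two]
    ring
  rw [h2, integral_add h01
    (integrableOn_cornerSimplex (hg 1)), integral_add (integrableOn_cornerSimplex hg')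
    (integrableOn_cornerSimplex (hg 0)), h1, h0]
  ring

/-- The partial derivative, in the direction of `t i`, of
`(t i - 1 / 4) * simplexForm c t ^ (-3 / 2)`. -/
noncomputable def coneDensity (c : ℝ) (i : Fin 3) (t : Fin 3 → ℝ) : ℝ :=
  (simplexForm c t - 3 * (1 - c) * (t i - 1 / 4) * (t i - (1 - ∑ j, t j))) *
    simplexForm c t ^ (-5 / 2 : ℝ)

theorem continuousOn_coneDensity {c : ℝ} (hc : 0 < 1 + 3 * c) (i : Fin 3) :
    ContinuousOn (coneDensity c i) (cornerSimplex 3) := by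
  have := continuous_simplexForm c 3
  exact ContinuousOn.mul (by fun_prop) (continuousOn_simplexForm_rpow (by exact_mod_cast hc) _)

theorem hasDerivAt_coneDensity {c x : ℝ} {u : Fin 2 → ℝ}
    (h : 0 < simplexForm c (Fin.cons x u : Fin 3 → ℝ)) :
    HasDerivAt (fun x : ℝ => (x - 1 / 4) *
      simplexForm c (Fin.cons x u : Fin 3 → ℝ) ^ (-3 / 2 : ℝ))
      (coneDensity c 0 (Fin.cons x u)) x := by
  have h1 : HasDerivAt (fun x : ℝ => simplexForm c (Fin.cons x u : Fin 3 → ℝ))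
      ((1 - c) * (2 * (x - (1 - (x + ∑ i, u i))))) x := by
    simp only [simplexForm_cons]
    have ha : HasDerivAt (fun x : ℝ => 1 - (x + ∑ i, u i)) (-1) x :=
      ((hasDerivAt_id x).add_const _).const_sub 1
    have := (((ha.pow 2).add ((hasDerivAt_pow 2 x).add_const (∑ i, u i ^ 2))).const_mul
      (1 - c)).const_add c
    refine this.congr_deriv ?_
    push_cast
    ring
  have h2 := ((hasDerivAt_id x).sub_const (1 / 4)).mul
    (h1.rpow_const (p := (-3 / 2 : ℝ)) (Or.inl h.ne'))
  refine h2.congr_deriv ?_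
  have h3 : simplexForm c (Fin.cons x u : Fin 3 → ℝ) ^ (-3 / 2 : ℝ) =
      simplexForm c (Fin.cons x u : Fin 3 → ℝ) *
        simplexForm c (Fin.cons x u : Fin 3 → ℝ) ^ (-5 / 2 : ℝ) := by
    conv_rhs => lhs; rw [← Real.rpow_one (simplexForm c _)]
    rw [← Real.rpow_add h]
    norm_num
  have h4 : ∑ j, (Fin.cons x u : Fin 3 → ℝ) j = x + ∑ i, u i := by
    rw [Fin.sum_univ_succ]
    simp
  have h5 : (-3 / 2 : ℝ) - 1 = -5 / 2 := by norm_num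
  rw [coneDensity, h4, h3, h5, Fin.cons_zero]
  simp only [id]
  ring

theorem setIntegral_coneDensity_zero {c : ℝ} (hc : 0 < 1 + 3 * c) :
    ∫ t in cornerSimplex 3, coneDensity c 0 t =
      ∫ u in cornerSimplex 2, (1 - ∑ i, u i) * simplexForm c u ^ (-3 / 2 : ℝ) := by
  have hcont := continuousOn_coneDensity hc 0
  rw [setIntegral_cornerSimplex_succ hcont]
  refine setIntegral_congr_fun (measurableSet_cornerSimplex 2) fun u hu => ?_
  have h01 : (0 : ℝ) ≤ 1 - ∑ i, u i := by linarith [hu.2]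
  have hmem : ∀ x ∈ Set.uIcc 0 (1 - ∑ i, u i), (Fin.cons x u : Fin 3 → ℝ) ∈ cornerSimplex 3 := by
    intro x hx
    rw [Set.uIcc_of_le h01] at hx
    exact cons_mem_cornerSimplex.2 ⟨hu, hx⟩
  have hcons : Continuous fun x : ℝ => (Fin.cons x u : Fin 3 → ℝ) := by
    refine continuous_pi fun i => ?_
    refine Fin.cases ?_ (fun i => ?_) i
    · simpa using continuous_id'
    · simpa using continuous_const
  have hi : IntervalIntegrable (fun x => coneDensity c 0 (Fin.cons x u)) volume 0
      (1 - ∑ i, u i) :=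
    ContinuousOn.intervalIntegrable (hcont.comp hcons.continuousOn hmem)
  rw [intervalIntegral.integral_eq_sub_of_hasDerivAt
    (fun x hx => hasDerivAt_coneDensity (simplexForm_pos (by exact_mod_cast hc) (hmem x hx))) hi]
  -- Both ends of the slice lie on faces of the tetrahedron, where the form restricts to that of the
  -- triangle. The boundary coefficients `(1 - ∑ i, u i) - 1 / 4` and `1 / 4` then add up to `1 - ∑
  -- i, u i`.
  have e1 : simplexForm c (Fin.cons (1 - ∑ i, u i) u : Fin 3 → ℝ) = simplexForm c u := by
    rw [simplexForm_cons, simplexForm_eq]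
    ring
  have e2 : simplexForm c (Fin.cons 0 u : Fin 3 → ℝ) = simplexForm c u := by
    rw [simplexForm_cons, simplexForm_eq]
    ring
  rw [e1, e2]
  ring

theorem setIntegral_coneDensity {c : ℝ} (i : Fin 3) :
    ∫ t in cornerSimplex 3, coneDensity c i t = ∫ t in cornerSimplex 3, coneDensity c 0 t := by
  rw [← setIntegral_cornerSimplex_perm (coneDensity c 0) (Equiv.swap 0 i)]
  congr 1
  funext t
  simp only [coneDensity, simplexForm_perm, Equiv.swap_apply_left,
    Equiv.sum_comp (Equiv.swap 0 i) t]

/-- With q quadratic about its critical point b and β = q(b), Euler's relation gives (t - b)·∇q =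
2(q - β). Hence the divergence is 3q^(-3/2) - 3(q - β)q^(-5/2) = 3βq^(-5/2). -/
theorem sum_coneDensity (c : ℝ) {t : Fin 3 → ℝ} :
    ∑ i, coneDensity c i t = 3 * ((1 + 3 * c) / 4) * simplexForm c t ^ (-5 / 2 : ℝ) := by
  simp only [coneDensity, ← Finset.sum_mul]
  congr 1
  simp only [simplexForm_eq, Fin.sum_univ_three]
  ring

/-- The divergence theorem for the radial field `(x - b) * q ^ (-3 / 2)` of the tetrahedron with
barycenter `b`, whose divergence is a multiple of `q ^ (-5 / 2)`. -/
theorem setIntegral_simplexForm_rpow_neg_five_halves {c : ℝ} (hc : 0 < 1 + 3 * c) :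
    3 * ((1 + 3 * c) / 4) * ∫ t in cornerSimplex 3, simplexForm c t ^ (-5 / 2 : ℝ) =
      ∫ t in cornerSimplex 2, simplexForm c t ^ (-3 / 2 : ℝ) := by
  rw [← setIntegral_one_sub_sum_mul (by linarith), ← setIntegral_coneDensity_zero hc,
    ← integral_const_mul]
  simp only [← sum_coneDensity]
  rw [integral_finsetSum _ fun i _ => integrableOn_cornerSimplex (continuousOn_coneDensity hc i)]
  simp only [setIntegral_coneDensity, Finset.sum_const, Finset.card_univ, Fintype.card_fin,
    nsmul_eq_mul, Nat.cast_ofNat]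

/-! ### Comparison of the integrals with barycentric values. -/

theorem volume_cornerSimplex_three_ne_zero : volume (cornerSimplex 3) ≠ 0 := by
  intro h
  have := setIntegral_cornerSimplex_three_one
  rw [Measure.restrict_eq_zero.2 h] at this
  norm_num at this

theorem sqrt_mul_rpow_neg_five_halves_lt {a q : ℝ} (hq : 0 < q) (h : a < q) :
    √a * q ^ (-5 / 2 : ℝ) < q ^ (-2 : ℝ) := by
  have e : q ^ (-2 : ℝ) = √q * q ^ (-5 / 2 : ℝ) := by
    rw [Real.sqrt_eq_rpow, ← Real.rpow_add hq]
    norm_num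
  rw [e]
  exact mul_lt_mul_of_pos_right (Real.sqrt_lt_sqrt_iff_of_pos hq |>.2 h) (by positivity)

theorem lt_sqrt_mul_rpow_neg_five_halves {a q : ℝ} (hq : 0 < q) (h : q < a) :
    q ^ (-2 : ℝ) < √a * q ^ (-5 / 2 : ℝ) := by
  have e : q ^ (-2 : ℝ) = √q * q ^ (-5 / 2 : ℝ) := by
    rw [Real.sqrt_eq_rpow, ← Real.rpow_add hq]
    norm_num
  rw [e]
  exact mul_lt_mul_of_pos_right (Real.sqrt_lt_sqrt hq.le h) (by positivity)

/-- Here β = (1+3c)/4 is the minimum of q, so √β q^(-5/2) < q^(-2) away from the barycenter; the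
divergence identity turns the left side into the triangle integral. -/
theorem setIntegral_two_lt_setIntegral_three {c : ℝ} (hc : 0 < 1 + 3 * c) (h1 : c < 1) :
    ∫ t in cornerSimplex 2, simplexForm c t ^ (-3 / 2 : ℝ) <
      3 * √((1 + 3 * c) / 4) * ∫ t in cornerSimplex 3, simplexForm c t ^ (-2 : ℝ) := by
  have hc' : 0 < 1 + ((3 : ℕ) : ℝ) * c := by exact_mod_cast hc
  have ha : 0 < √((1 + 3 * c) / 4) := by positivity
  have h := setIntegral_lt_setIntegral_cornerSimplex volume_cornerSimplex_three_ne_zero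
    ((continuousOn_simplexForm_rpow hc' (-5 / 2)).const_mul √((1 + 3 * c) / 4))
    (continuousOn_simplexForm_rpow hc' (-2)) (fun _ => 1 / (((3 : ℕ) : ℝ) + 1))
    (measure_singleton _) fun t ht htb => by
      have := lt_simplexForm h1 htb
      norm_num at this
      exact sqrt_mul_rpow_neg_five_halves_lt (simplexForm_pos hc' ht) this
  rw [integral_const_mul] at h
  rw [← setIntegral_simplexForm_rpow_neg_five_halves hc]
  calc _ = 3 * √((1 + 3 * c) / 4) * (√((1 + 3 * c) / 4) *
        ∫ t in cornerSimplex 3, simplexForm c t ^ (-5 / 2 : ℝ)) := by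
        rw [← mul_assoc (3 * √_), mul_assoc 3 √_, Real.mul_self_sqrt (by positivity)]
    _ < _ := mul_lt_mul_of_pos_left h (by positivity)

theorem setIntegral_three_lt_setIntegral_two {c : ℝ} (h1 : 1 < c) :
    3 * √((1 + 3 * c) / 4) * ∫ t in cornerSimplex 3, simplexForm c t ^ (-2 : ℝ) <
      ∫ t in cornerSimplex 2, simplexForm c t ^ (-3 / 2 : ℝ) := by
  have hc : 0 < 1 + 3 * c := by linarith
  have hc' : 0 < 1 + ((3 : ℕ) : ℝ) * c := by exact_mod_cast hc
  have ha : 0 < √((1 + 3 * c) / 4) := by positivity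
  have h := setIntegral_lt_setIntegral_cornerSimplex volume_cornerSimplex_three_ne_zero
    (continuousOn_simplexForm_rpow hc' (-2))
    ((continuousOn_simplexForm_rpow hc' (-5 / 2)).const_mul √((1 + 3 * c) / 4))
    (fun _ => 1 / (((3 : ℕ) : ℝ) + 1))
    (measure_singleton _) fun t ht htb => by
      have := simplexForm_lt h1 htb
      norm_num at this
      exact lt_sqrt_mul_rpow_neg_five_halves (simplexForm_pos hc' ht) this
  rw [integral_const_mul] at h
  rw [← setIntegral_simplexForm_rpow_neg_five_halves hc]
  calc _ < 3 * √((1 + 3 * c) / 4) * (√((1 + 3 * c) / 4) *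
        ∫ t in cornerSimplex 3, simplexForm c t ^ (-5 / 2 : ℝ)) :=
        mul_lt_mul_of_pos_left h (by positivity)
    _ = _ := by
        rw [← mul_assoc, mul_assoc 3, Real.mul_self_sqrt (by positivity)]

theorem setIntegral_two_le {c : ℝ} (hc : 0 < 1 + 2 * c) (h1 : c ≤ 1) :
    ∫ t in cornerSimplex 2, simplexForm c t ^ (-3 / 2 : ℝ) ≤
      1 / 2 * ((1 + 2 * c) / 3) ^ (-3 / 2 : ℝ) := by
  have hc' : 0 < 1 + ((2 : ℕ) : ℝ) * c := by exact_mod_cast hc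
  calc _ ≤ ∫ _ in cornerSimplex 2, ((1 + 2 * c) / 3) ^ (-3 / 2 : ℝ) * 1 := by
        refine setIntegral_mono_on (integrableOn_cornerSimplex (continuousOn_simplexForm_rpow hc' _))
          (integrableOn_cornerSimplex continuousOn_const) (measurableSet_cornerSimplex 2) ?_
        intro t _
        have := le_simplexForm h1 t
        norm_num at this
        rw [mul_one]
        exact Real.rpow_le_rpow_of_nonpos (by positivity) this (by norm_num)
    _ = _ := by
        rw [integral_const_mul, setIntegral_cornerSimplex_two_one]
        ring

theorem le_setIntegral_two {c : ℝ} (h1 : 1 ≤ c) :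
    1 / 2 * ((1 + 2 * c) / 3) ^ (-3 / 2 : ℝ) ≤
      ∫ t in cornerSimplex 2, simplexForm c t ^ (-3 / 2 : ℝ) := by
  have hc' : 0 < 1 + ((2 : ℕ) : ℝ) * c := by norm_num; linarith
  calc _ = ∫ _ in cornerSimplex 2, ((1 + 2 * c) / 3) ^ (-3 / 2 : ℝ) * 1 := by
        rw [integral_const_mul, setIntegral_cornerSimplex_two_one]
        ring
    _ ≤ _ := by
        refine setIntegral_mono_on (integrableOn_cornerSimplex continuousOn_const)
          (integrableOn_cornerSimplex (continuousOn_simplexForm_rpow hc' _))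
          (measurableSet_cornerSimplex 2) ?_
        intro t ht
        have := simplexForm_le h1 t
        norm_num at this
        rw [mul_one]
        exact Real.rpow_le_rpow_of_nonpos (simplexForm_pos hc' ht) this (by norm_num)

/-! ### Area and volume of curved regular simplices. -/

theorem sqrt_div_pow {D q : ℝ} (hq : 0 < q) (n : ℕ) :
    √(D / q ^ n) = √D * q ^ (-(n : ℝ) / 2) := by
  rw [Real.sqrt_div' _ (by positivity), div_eq_mul_inv, neg_div, Real.rpow_neg hq.le]
  congr 2
  rw [Real.sqrt_eq_rpow, ← Real.rpow_natCast, ← Real.rpow_mul hq.le]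
  congr 1
  ring

theorem HasRegularGram.simplexMeasure_two {K : SpaceKind} (hK : K ≠ .euclidean) {r c : ℝ}
    (hr : 0 < r) {P : Fin 3 → Fin 4 → ℝ} (h : HasRegularGram K r c P) (hc : 0 < 1 + 2 * c) :
    simplexMeasure K r (k := 2) P =
      r ^ 2 * |1 - c| * √(1 + 2 * c) *
        ∫ t in cornerSimplex 2, simplexForm c t ^ (-3 / 2 : ℝ) := by
  rw [simplexMeasure, ← integral_const_mul]
  refine setIntegral_congr_fun (measurableSet_cornerSimplex 2) fun t ht => ?_
  have hq : 0 < simplexForm c t := simplexForm_pos (by exact_mod_cast hc) ht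
  rw [abs_det_inducedMetric_two hK hr h hc.le t hq, sqrt_div_pow hq, Real.sqrt_mul (sq_nonneg _),
    Real.sqrt_sq (by positivity)]
  norm_num

theorem HasRegularGram.simplexMeasure_three {K : SpaceKind} (hK : K ≠ .euclidean) {r c : ℝ}
    (hr : 0 < r) {P : Fin 4 → Fin 4 → ℝ} (h : HasRegularGram K r c P) (hc : 0 < 1 + 3 * c) :
    simplexMeasure K r (k := 3) P =
      √((r ^ 2 * |1 - c|) ^ 3 * (1 + 3 * c)) *
        ∫ t in cornerSimplex 3, simplexForm c t ^ (-2 : ℝ) := by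
  rw [simplexMeasure, ← integral_const_mul]
  refine setIntegral_congr_fun (measurableSet_cornerSimplex 3) fun t ht => ?_
  have hq : 0 < simplexForm c t := simplexForm_pos (by exact_mod_cast hc) ht
  rw [abs_det_inducedMetric_three hK hr h hc.le t hq, sqrt_div_pow hq]
  norm_num

theorem setIntegral_simplexForm_rpow_nonneg {c : ℝ} {k : ℕ} (hc : 0 < 1 + k * c) (p : ℝ) :
    0 ≤ ∫ t : Fin k → ℝ in cornerSimplex k, simplexForm c t ^ p :=
  setIntegral_nonneg (measurableSet_cornerSimplex k) fun _ ht =>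
    Real.rpow_nonneg (simplexForm_pos hc ht).le _

/-- With `m = 1 + 2 * c` this evaluates the barycentric bound for the triangle integral; `m`
cancels, leaving a constant independent of the edge length. -/
theorem sqrt_pow_three_mul_rpow {m : ℝ} (hm : 0 < m) :
    √m ^ 3 * (1 / 2 * (m / 3) ^ (-3 / 2 : ℝ)) = 3 * √3 / 2 := by
  have h : (m / 3) ^ (-3 / 2 : ℝ) = 3 * √3 / √m ^ 3 := by
    have h1 : ∀ x : ℝ, 0 < x → x ^ (3 / 2 : ℝ) = √x ^ 3 := fun x hx => by
      rw [Real.sqrt_eq_rpow, ← Real.rpow_natCast, ← Real.rpow_mul hx.le]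
      norm_num
    rw [neg_div, Real.rpow_neg (by positivity), h1 _ (by positivity), Real.sqrt_div hm.le, div_pow,
      inv_div]
    congr 1
    rw [pow_succ, Real.sq_sqrt (by norm_num)]
  have : √m ≠ 0 := (Real.sqrt_pos.2 hm).ne'
  rw [h]
  field_simp

theorem three_mul_sqrt_div_four_mul_sq {s I : ℝ} (hs : 0 ≤ s) :
    (3 * √(s / 4) * I) ^ 2 = 9 / 4 * (s * I ^ 2) := by
  rw [mul_pow, mul_pow, Real.sq_sqrt (by positivity)]
  ring

/-- For `c ≤ 1` the form is at most 1 on the simplex, so the integral is at least the area 1/2 of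
the parameter triangle. -/
theorem setIntegral_two_pos {c : ℝ} (hc : 0 < 1 + 2 * c) (h1 : c ≤ 1) :
    0 < ∫ t in cornerSimplex 2, simplexForm c t ^ (-3 / 2 : ℝ) := by
  have hc' : 0 < 1 + ((2 : ℕ) : ℝ) * c := by exact_mod_cast hc
  have h : ∫ _ in cornerSimplex 2, (1 : ℝ) ≤
      ∫ t in cornerSimplex 2, simplexForm c t ^ (-3 / 2 : ℝ) := by
    refine setIntegral_mono_on (integrableOn_cornerSimplex continuousOn_const)
      (integrableOn_cornerSimplex (continuousOn_simplexForm_rpow hc' _))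
      (measurableSet_cornerSimplex 2) fun t ht => ?_
    refine Real.one_le_rpow_of_pos_of_le_one_of_nonpos (simplexForm_pos hc' ht) ?_ (by norm_num)
    have := sum_baryCoord_sq_le_one ht
    rw [simplexForm]
    nlinarith
  rw [setIntegral_cornerSimplex_two_one] at h
  linarith

theorem HasRegularGram.area_cube_lt {K : SpaceKind} (hK : K ≠ .euclidean) {r c : ℝ}
    (hr : 0 < r) {P : Fin 4 → Fin 4 → ℝ} (h : HasRegularGram K r c P) (hc : 0 < 1 + 3 * c)
    (h1 : c < 1) (f : Fin 4) :
    0 < faceArea K r P f ∧ 8 * faceArea K r P f ^ 3 < 27 * √3 * tetraVolume K r P ^ 2 := by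
  have hc2 : 0 < 1 + 2 * c := by linarith
  rw [faceArea, tetraVolume, h.simplexMeasure_three hK hr hc,
    (h.comp f.succAbove_right_injective).simplexMeasure_two hK hr hc2]
  have h0 := setIntegral_two_pos hc2 h1.le
  have hA := mul_le_mul_of_nonneg_left (setIntegral_two_le hc2 h1.le)
    (by positivity : 0 ≤ √(1 + 2 * c) ^ 3)
  rw [sqrt_pow_three_mul_rpow hc2] at hA
  have hV := pow_lt_pow_left₀ (setIntegral_two_lt_setIntegral_three hc h1) h0.le two_ne_zero
  rw [three_mul_sqrt_div_four_mul_sq hc.le] at hV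
  have hR : 0 < r ^ 2 * |1 - c| := mul_pos (by positivity) (abs_pos.2 (by linarith))
  set I := ∫ t in cornerSimplex 2, simplexForm c t ^ (-3 / 2 : ℝ)
  set J := ∫ t in cornerSimplex 3, simplexForm c t ^ (-2 : ℝ)
  set R := r ^ 2 * |1 - c|
  refine ⟨by positivity, ?_⟩
  rw [mul_pow √(R ^ 3 * (1 + 3 * c)), Real.sq_sqrt (by positivity)]
  -- One factor of `I` absorbs `√(1 + 2 * c) ^ 3` and is bounded on the face; the remaining `I ^ 2`
  -- is compared with `J ^ 2` by the divergence identity.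
  calc 8 * (R * √(1 + 2 * c) * I) ^ 3 = 8 * R ^ 3 * I ^ 2 * (√(1 + 2 * c) ^ 3 * I) := by ring
    _ ≤ 8 * R ^ 3 * I ^ 2 * (3 * √3 / 2) := by gcongr
    _ = 12 * √3 * R ^ 3 * I ^ 2 := by ring
    _ < 12 * √3 * R ^ 3 * (9 / 4 * ((1 + 3 * c) * J ^ 2)) := by gcongr
    _ = _ := by ring

theorem HasRegularGram.lt_area_cube {K : SpaceKind} (hK : K ≠ .euclidean) {r c : ℝ}
    (hr : 0 < r) {P : Fin 4 → Fin 4 → ℝ} (h : HasRegularGram K r c P)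
    (h1 : 1 < c) (f : Fin 4) :
    0 ≤ faceArea K r P f ∧ 27 * √3 * tetraVolume K r P ^ 2 < 8 * faceArea K r P f ^ 3 := by
  have hc : 0 < 1 + 3 * c := by linarith
  have hc2 : 0 < 1 + 2 * c := by linarith
  rw [faceArea, tetraVolume, h.simplexMeasure_three hK hr hc,
    (h.comp f.succAbove_right_injective).simplexMeasure_two hK hr hc2]
  have h0 : 0 ≤ ∫ t in cornerSimplex 2, simplexForm c t ^ (-3 / 2 : ℝ) :=
    setIntegral_simplexForm_rpow_nonneg (by exact_mod_cast hc2) _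
  have h3 : 0 ≤ ∫ t in cornerSimplex 3, simplexForm c t ^ (-2 : ℝ) :=
    setIntegral_simplexForm_rpow_nonneg (by exact_mod_cast hc) _
  have hA := mul_le_mul_of_nonneg_left (le_setIntegral_two h1.le)
    (by positivity : 0 ≤ √(1 + 2 * c) ^ 3)
  rw [sqrt_pow_three_mul_rpow hc2] at hA
  have hV := pow_lt_pow_left₀ (setIntegral_three_lt_setIntegral_two h1) (by positivity) two_ne_zero
  rw [three_mul_sqrt_div_four_mul_sq hc.le] at hV
  have hR : 0 < r ^ 2 * |1 - c| :=
    mul_pos (by positivity) (abs_pos.2 (by linarith))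
  set I := ∫ t in cornerSimplex 2, simplexForm c t ^ (-3 / 2 : ℝ)
  set J := ∫ t in cornerSimplex 3, simplexForm c t ^ (-2 : ℝ)
  set R := r ^ 2 * |1 - c|
  refine ⟨by positivity, ?_⟩
  rw [mul_pow √(R ^ 3 * (1 + 3 * c)), Real.sq_sqrt (by positivity)]
  calc 27 * √3 * (R ^ 3 * (1 + 3 * c) * J ^ 2)
      = 12 * √3 * R ^ 3 * (9 / 4 * ((1 + 3 * c) * J ^ 2)) := by ring
    _ < 12 * √3 * R ^ 3 * I ^ 2 := by gcongr
    _ = 8 * R ^ 3 * I ^ 2 * (3 * √3 / 2) := by ring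
    _ ≤ 8 * R ^ 3 * I ^ 2 * (√(1 + 2 * c) ^ 3 * I) := by gcongr
    _ = _ := by ring

/-! ### The Euclidean constant and the ratio in the curved cases. -/

theorem rpow_three_halves_sq {x : ℝ} (hx : 0 ≤ x) : (x ^ (3 / 2 : ℝ)) ^ 2 = x ^ 3 := by
  rw [← Real.rpow_natCast, ← Real.rpow_mul hx]
  norm_num

theorem euclideanRatio_pos : 0 < euclideanRatio := by
  rw [euclideanRatio]
  positivity

theorem euclideanRatio_sq : euclideanRatio ^ 2 = 8 / (27 * √3) := by
  have h3 : √3 ^ 2 = 3 := Real.sq_sqrt (by norm_num)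
  have : √3 ≠ 0 := by positivity
  rw [euclideanRatio, div_pow, mul_pow, rpow_three_halves_sq (by positivity),
    Real.sq_sqrt (by norm_num), div_pow, pow_succ √3 2, h3]
  field_simp
  norm_num

theorem abs_euclideanRatio_sub_lt : |euclideanRatio - 0.4136| < 0.00005 := by
  have h3 : √3 ^ 2 = 3 := Real.sq_sqrt (by norm_num)
  have hp : 0 < √3 := by positivity
  have hl : 1.732 < √3 := Real.lt_sqrt (by norm_num) |>.2 (by norm_num)
  have hu : √3 < 1.7321 := Real.sqrt_lt' (by norm_num) |>.2 (by norm_num)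
  have h1 : 0.41355 < euclideanRatio := by
    refine lt_of_pow_lt_pow_left₀ 2 euclideanRatio_pos.le ?_
    rw [euclideanRatio_sq, lt_div_iff₀ (by positivity)]
    linarith
  have h2 : euclideanRatio < 0.41365 := by
    refine lt_of_pow_lt_pow_left₀ 2 (by norm_num) ?_
    rw [euclideanRatio_sq, div_lt_iff₀ (by positivity)]
    linarith
  rw [abs_lt]
  constructor <;> linarith

theorem tetraVolume_nonneg (K : SpaceKind) (r : ℝ) (P : Fin 4 → Fin 4 → ℝ) :
    0 ≤ tetraVolume K r P :=
  integral_nonneg fun _ => Real.sqrt_nonneg _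

theorem volumeAreaRatio_nonneg {K : SpaceKind} {r : ℝ} {P : Fin 4 → Fin 4 → ℝ} {f : Fin 4}
    (hA : 0 ≤ faceArea K r P f) : 0 ≤ volumeAreaRatio K r P f :=
  div_nonneg (tetraVolume_nonneg K r P) (Real.rpow_nonneg hA _)

theorem volumeAreaRatio_sq {K : SpaceKind} {r : ℝ} {P : Fin 4 → Fin 4 → ℝ} {f : Fin 4}
    (hA : 0 ≤ faceArea K r P f) :
    volumeAreaRatio K r P f ^ 2 = tetraVolume K r P ^ 2 / faceArea K r P f ^ 3 := by
  rw [volumeAreaRatio, div_pow, rpow_three_halves_sq hA]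

theorem HasRegularGram.volumeAreaRatio_lt {K : SpaceKind} (hK : K ≠ .euclidean) {r c : ℝ}
    (hr : 0 < r) {P : Fin 4 → Fin 4 → ℝ} (h : HasRegularGram K r c P) (h1 : 1 < c) (f : Fin 4) :
    volumeAreaRatio K r P f < euclideanRatio := by
  obtain ⟨hA, hl⟩ := h.lt_area_cube hK hr h1 f
  refine lt_of_pow_lt_pow_left₀ 2 euclideanRatio_pos.le ?_
  -- Positivity of the area comes for free: its cube strictly exceeds a nonnegative quantity.
  have hA3 : 0 < faceArea K r P f ^ 3 := by
    have : 0 ≤ 27 * √3 * tetraVolume K r P ^ 2 := by positivity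
    linarith
  rw [volumeAreaRatio_sq hA, euclideanRatio_sq, div_lt_div_iff₀ hA3 (by positivity)]
  linarith

theorem HasRegularGram.lt_volumeAreaRatio {K : SpaceKind} (hK : K ≠ .euclidean) {r c : ℝ}
    (hr : 0 < r) {P : Fin 4 → Fin 4 → ℝ} (h : HasRegularGram K r c P) (hc : 0 < 1 + 3 * c)
    (h1 : c < 1) (f : Fin 4) : euclideanRatio < volumeAreaRatio K r P f := by
  obtain ⟨hA, hl⟩ := h.area_cube_lt hK hr hc h1 f
  refine lt_of_pow_lt_pow_left₀ 2 (volumeAreaRatio_nonneg hA.le) ?_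
  rw [volumeAreaRatio_sq hA.le, euclideanRatio_sq, div_lt_div_iff₀ (by positivity) (by positivity)]
  linarith

/-! ### From edge lengths to the Gram matrix. -/

theorem hasRegularGram_pair {K : SpaceKind} {r c : ℝ} {X Y : Fin 4 → ℝ}
    (hX : ambientForm K X X = K.epsSq * r ^ 2) (hY : ambientForm K Y Y = K.epsSq * r ^ 2)
    (hXY : ambientForm K X Y = K.epsSq * r ^ 2 * c) : HasRegularGram K r c ![X, Y] := by
  have hYX : ambientForm K Y X = K.epsSq * r ^ 2 * c := by
    rw [← hXY]
    simp only [ambientForm]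
    ring
  intro i j
  fin_cases i <;> fin_cases j <;> simp [hX, hY, hXY, hYX]

theorem hasDerivAt_arctan_segment (r τ x : ℝ) :
    HasDerivAt (fun x : ℝ => r * Real.arctan (τ * (2 * x - 1)))
      (2 * r * τ / (1 + τ ^ 2 * (2 * x - 1) ^ 2)) x := by
  have h : HasDerivAt (fun x : ℝ => τ * (2 * x - 1)) (τ * 2) x := by
    simpa using (((hasDerivAt_id x).const_mul 2).sub_const 1).const_mul τ
  refine (h.arctan.const_mul r).congr_deriv ?_
  rw [mul_pow]
  ring

theorem hasDerivAt_log_segment {r τ x : ℝ} (h1 : 0 < 1 + τ * (2 * x - 1))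
    (h2 : 0 < 1 - τ * (2 * x - 1)) :
    HasDerivAt (fun x : ℝ => r / 2 * (Real.log (1 + τ * (2 * x - 1)) -
        Real.log (1 - τ * (2 * x - 1))))
      (2 * r * τ / (1 - τ ^ 2 * (2 * x - 1) ^ 2)) x := by
  have h : HasDerivAt (fun x : ℝ => τ * (2 * x - 1)) (τ * 2) x := by
    simpa using (((hasDerivAt_id x).const_mul 2).sub_const 1).const_mul τ
  refine ((((h.const_add 1).log h1.ne').sub ((h.const_sub 1).log h2.ne')).const_mul
    (r / 2)).congr_deriv ?_
  have e : 1 - τ ^ 2 * (2 * x - 1) ^ 2 = (1 + τ * (2 * x - 1)) * (1 - τ * (2 * x - 1)) := by ring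
  rw [e]
  field_simp
  ring

/-- Half-angle substitution: `τ` is the tangent of half the central angle, so `c` is its cosine. It
makes the density rational, with an arctangent as primitive. -/
theorem HasRegularGram.simplexMeasure_one_of_lt {K : SpaceKind} (hK : K ≠ .euclidean) {r τ : ℝ}
    (hr : 0 < r) (hτ : 0 ≤ τ) {P : Fin 2 → Fin 4 → ℝ}
    (h : HasRegularGram K r ((1 - τ ^ 2) / (1 + τ ^ 2)) P) :
    simplexMeasure K r (k := 1) P = 2 * r * Real.arctan τ := by
  have hp : 0 < 1 + τ ^ 2 := by positivity
  have hc : 0 < 1 + (1 - τ ^ 2) / (1 + τ ^ 2) := by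
    have : 1 + (1 - τ ^ 2) / (1 + τ ^ 2) = 2 / (1 + τ ^ 2) := by field_simp; ring
    rw [this]
    positivity
  have hd : ∀ y : ℝ, 0 < 1 + τ ^ 2 * (2 * y - 1) ^ 2 := fun y => by positivity
  have e : ∀ t ∈ cornerSimplex 1, √|(inducedMetric K r P t).det| =
      2 * r * τ / (1 + τ ^ 2 * (2 * t 0 - 1) ^ 2) := by
    intro t ht
    have hq : simplexForm ((1 - τ ^ 2) / (1 + τ ^ 2)) t =
        (1 + τ ^ 2 * (2 * t 0 - 1) ^ 2) / (1 + τ ^ 2) := by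
      rw [simplexForm_eq]
      simp only [Fin.sum_univ_one]
      field_simp
      ring
    rw [abs_det_inducedMetric_one hK hr h hc.le t (by rw [hq]; exact div_pos (hd _) hp), hq]
    have h1 : |1 - (1 - τ ^ 2) / (1 + τ ^ 2)| = 2 * τ ^ 2 / (1 + τ ^ 2) := by
      have : 1 - (1 - τ ^ 2) / (1 + τ ^ 2) = 2 * τ ^ 2 / (1 + τ ^ 2) := by field_simp; ring
      rw [this, abs_of_nonneg (by positivity)]
    rw [h1, Real.sqrt_eq_iff_mul_self_eq (by positivity) (by have := hd (t 0); positivity)]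
    have := (hd (t 0)).ne'
    field_simp
    ring
  have hcont : Continuous fun x : ℝ => 2 * r * τ / (1 + τ ^ 2 * (2 * x - 1) ^ 2) :=
    continuous_const.div (by fun_prop) fun x => (hd x).ne'
  rw [simplexMeasure, setIntegral_congr_fun (measurableSet_cornerSimplex 1) e,
    setIntegral_cornerSimplex_one
      (g := fun t => 2 * r * τ / (1 + τ ^ 2 * (2 * t 0 - 1) ^ 2))
      (hcont.comp (continuous_apply 0)).continuousOn,
    intervalIntegral.integral_eq_sub_of_hasDerivAt (fun x _ => hasDerivAt_arctan_segment r τ x)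
      (hcont.intervalIntegrable _ _)]
  norm_num
  ring

/-- Hyperbolic half-angle substitution: `τ` is tanh of half the distance divided by `r`, and the
difference of logarithms is 2 artanh `τ`. -/
theorem HasRegularGram.simplexMeasure_one_of_gt {K : SpaceKind} (hK : K ≠ .euclidean) {r τ : ℝ}
    (hr : 0 < r) (hτ : 0 ≤ τ) (hτ1 : τ < 1) {P : Fin 2 → Fin 4 → ℝ}
    (h : HasRegularGram K r ((1 + τ ^ 2) / (1 - τ ^ 2)) P) :
    simplexMeasure K r (k := 1) P = r * (Real.log (1 + τ) - Real.log (1 - τ)) := by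
  have hp : 0 < 1 - τ ^ 2 := by nlinarith
  have hc : 0 < 1 + (1 + τ ^ 2) / (1 - τ ^ 2) := by positivity
  have hy : ∀ y ∈ Set.Icc (0 : ℝ) 1, 0 < 1 + τ * (2 * y - 1) ∧ 0 < 1 - τ * (2 * y - 1) := by
    intro y hy
    have h0 := mul_nonneg hτ hy.1
    have h1 := mul_nonneg hτ (sub_nonneg.2 hy.2)
    constructor <;> linarith
  have hd : ∀ y ∈ Set.Icc (0 : ℝ) 1, 0 < 1 - τ ^ 2 * (2 * y - 1) ^ 2 := by
    intro y h
    have := mul_pos (hy y h).1 (hy y h).2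
    linarith
  have hm : ∀ t ∈ cornerSimplex 1, t 0 ∈ Set.Icc (0 : ℝ) 1 := fun t ht =>
    ⟨ht.1 0, by simpa using ht.2⟩
  have e : ∀ t ∈ cornerSimplex 1, √|(inducedMetric K r P t).det| =
      2 * r * τ / (1 - τ ^ 2 * (2 * t 0 - 1) ^ 2) := by
    intro t ht
    have hq : simplexForm ((1 + τ ^ 2) / (1 - τ ^ 2)) t =
        (1 - τ ^ 2 * (2 * t 0 - 1) ^ 2) / (1 - τ ^ 2) := by
      rw [simplexForm_eq]
      simp only [Fin.sum_univ_one]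
      field_simp
      ring
    have hdt := hd _ (hm t ht)
    rw [abs_det_inducedMetric_one hK hr h hc.le t (by rw [hq]; exact div_pos hdt hp), hq]
    have h1 : |1 - (1 + τ ^ 2) / (1 - τ ^ 2)| = 2 * τ ^ 2 / (1 - τ ^ 2) := by
      have : 1 - (1 + τ ^ 2) / (1 - τ ^ 2) = -(2 * τ ^ 2 / (1 - τ ^ 2)) := by field_simp; ring
      rw [this, abs_neg, abs_of_nonneg (by positivity)]
    rw [h1, Real.sqrt_eq_iff_mul_self_eq (by positivity) (by positivity)]
    field_simp
    ring
  have hcont : ContinuousOn (fun x : ℝ => 2 * r * τ / (1 - τ ^ 2 * (2 * x - 1) ^ 2))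
      (Set.Icc 0 1) :=
    continuousOn_const.div (by fun_prop) fun x hx => (hd x hx).ne'
  have hI : Set.uIcc (0 : ℝ) 1 = Set.Icc 0 1 := Set.uIcc_of_le zero_le_one
  rw [simplexMeasure, setIntegral_congr_fun (measurableSet_cornerSimplex 1) e,
    setIntegral_cornerSimplex_one
      (g := fun t => 2 * r * τ / (1 - τ ^ 2 * (2 * t 0 - 1) ^ 2))
      (hcont.comp (continuous_apply 0).continuousOn hm),
    intervalIntegral.integral_eq_sub_of_hasDerivAt
      (fun x hx => hasDerivAt_log_segment (r := r) (hy x (hI ▸ hx)).1 (hy x (hI ▸ hx)).2)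
      (ContinuousOn.intervalIntegrable (by rwa [hI]))]
  norm_num
  ring_nf

/-- The chord of antipodal points runs through the origin, and its projection is constant on either
side of the midpoint. Such pairs thus have measure 0 and are excluded by a positive edge length. -/
theorem HasRegularGram.simplexMeasure_one_of_antipodal {K : SpaceKind} (hK : K ≠ .euclidean)
    {r : ℝ} (hr : 0 < r) {P : Fin 2 → Fin 4 → ℝ} (h : HasRegularGram K r (-1) P) :
    simplexMeasure K r (k := 1) P = 0 := by
  rw [simplexMeasure]
  have hb : ∀ᵐ t ∂(volume : Measure (Fin 1 → ℝ)), t ≠ fun _ => 1 / 2 := by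
    rw [ae_iff]
    simp
  refine integral_eq_zero_of_ae (ae_restrict_of_ae ?_)
  filter_upwards [hb] with t ht
  have ht0 : 1 - 2 * t 0 ≠ 0 := by
    intro h0
    refine ht (funext fun i => ?_)
    rw [Subsingleton.elim i 0]
    linarith
  have hq : simplexForm (-1) t = (1 - 2 * t 0) ^ 2 := by
    rw [simplexForm_eq]
    simp only [Fin.sum_univ_one]
    ring
  rw [abs_det_inducedMetric_one hK hr h (by norm_num) t (by rw [hq]; positivity)]
  norm_num

theorem sphere_inner_bounds {r : ℝ} {X Y : Fin 4 → ℝ}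
    (hX : ambientForm .spherical X X = r ^ 2) (hY : ambientForm .spherical Y Y = r ^ 2) :
    -r ^ 2 ≤ ambientForm .spherical X Y ∧ ambientForm .spherical X Y ≤ r ^ 2 := by
  simp only [ambientForm, SpaceKind.epsSq] at *
  constructor
  · nlinarith [sq_nonneg (X 0 + Y 0), sq_nonneg (X 1 + Y 1), sq_nonneg (X 2 + Y 2),
      sq_nonneg (X 3 + Y 3)]
  · nlinarith [sq_nonneg (X 0 - Y 0), sq_nonneg (X 1 - Y 1), sq_nonneg (X 2 - Y 2),
      sq_nonneg (X 3 - Y 3)]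

/-- Reversed Cauchy–Schwarz inequality for future-directed timelike vectors. -/
theorem hyperboloid_inner_bound {r : ℝ} {X Y : Fin 4 → ℝ}
    (hX : ambientForm .hyperbolic X X = -r ^ 2) (hY : ambientForm .hyperbolic Y Y = -r ^ 2)
    (hX3 : 0 < X 3) (hY3 : 0 < Y 3) : ambientForm .hyperbolic X Y ≤ -r ^ 2 := by
  simp only [ambientForm, SpaceKind.epsSq] at *
  have h : X 0 * Y 0 + X 1 * Y 1 + X 2 * Y 2 + r ^ 2 ≤ X 3 * Y 3 := by
    refine le_of_sq_le_sq ?_ (by positivity)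
    have e : (X 3 * Y 3) ^ 2 = (X 0 * X 0 + X 1 * X 1 + X 2 * X 2 + r ^ 2) *
        (Y 0 * Y 0 + Y 1 * Y 1 + Y 2 * Y 2 + r ^ 2) := by
      rw [mul_pow]
      congr 1 <;> linarith
    rw [e]
    -- Lagrange's identity: this sum of squares is exactly the difference of the two sides.
    have hn : 0 ≤ (X 0 * Y 1 - X 1 * Y 0) ^ 2 + (X 0 * Y 2 - X 2 * Y 0) ^ 2 +
        (X 1 * Y 2 - X 2 * Y 1) ^ 2 + r ^ 2 * ((X 0 - Y 0) ^ 2 + (X 1 - Y 1) ^ 2 +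
          (X 2 - Y 2) ^ 2) := by positivity
    linarith
  linarith

theorem spherical_edge {r a : ℝ} (hr : 0 < r) (ha : 0 < a) {X Y : Fin 4 → ℝ}
    (hX : X ∈ modelSpace .spherical r) (hY : Y ∈ modelSpace .spherical r)
    (h : simplexMeasure .spherical r (k := 1) ![X, Y] = a) :
    ∃ τ, 0 < τ ∧ 2 * r * Real.arctan τ = a ∧
      ambientForm .spherical X Y = r ^ 2 * ((1 - τ ^ 2) / (1 + τ ^ 2)) := by
  have hX' : ambientForm .spherical X X = r ^ 2 := hX
  have hY' : ambientForm .spherical Y Y = r ^ 2 := hY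
  obtain ⟨hl, hu⟩ := sphere_inner_bounds hX' hY'
  have hr2 : 0 < r ^ 2 := by positivity
  obtain ⟨c, hc⟩ : ∃ c, ambientForm .spherical X Y = r ^ 2 * c :=
    ⟨ambientForm .spherical X Y / r ^ 2, by field_simp⟩
  have hc1 : c ≤ 1 := by rw [hc] at hu; nlinarith
  have hc0 : -1 ≤ c := by rw [hc] at hl; nlinarith
  have hg : HasRegularGram .spherical r c ![X, Y] :=
    hasRegularGram_pair (by simpa [SpaceKind.epsSq] using hX')
      (by simpa [SpaceKind.epsSq] using hY') (by simpa [SpaceKind.epsSq] using hc)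
  rcases hc0.eq_or_lt with h1 | h1
  · rw [← h1] at hg
    rw [hg.simplexMeasure_one_of_antipodal (by simp) hr] at h
    exact absurd h ha.ne
  · have hp : 0 < 1 + c := by linarith
    have hsq : √((1 - c) / (1 + c)) ^ 2 = (1 - c) / (1 + c) :=
      Real.sq_sqrt (div_nonneg (by linarith) hp.le)
    have hcτ : c = (1 - √((1 - c) / (1 + c)) ^ 2) / (1 + √((1 - c) / (1 + c)) ^ 2) := by
      rw [hsq]
      field_simp
      ring
    set τ := √((1 - c) / (1 + c))
    rw [hcτ] at hg
    rw [hg.simplexMeasure_one_of_lt (by simp) hr (Real.sqrt_nonneg _)] at h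
    refine ⟨τ, (Real.sqrt_nonneg _).lt_of_ne' fun h0 => ?_, h, by rw [hc, ← hcτ]⟩
    rw [h0, Real.arctan_zero, mul_zero] at h
    exact ha.ne h

theorem hyperbolic_edge {r a : ℝ} (hr : 0 < r) (ha : 0 < a) {X Y : Fin 4 → ℝ}
    (hX : X ∈ modelSpace .hyperbolic r) (hY : Y ∈ modelSpace .hyperbolic r)
    (h : simplexMeasure .hyperbolic r (k := 1) ![X, Y] = a) :
    ∃ τ, 0 < τ ∧ τ < 1 ∧ r * (Real.log (1 + τ) - Real.log (1 - τ)) = a ∧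
      ambientForm .hyperbolic X Y = -r ^ 2 * ((1 + τ ^ 2) / (1 - τ ^ 2)) := by
  obtain ⟨hX', hX3⟩ := hX
  obtain ⟨hY', hY3⟩ := hY
  have hu := hyperboloid_inner_bound hX' hY' hX3 hY3
  have hr2 : 0 < r ^ 2 := by positivity
  obtain ⟨c, hc⟩ : ∃ c, ambientForm .hyperbolic X Y = -r ^ 2 * c :=
    ⟨-ambientForm .hyperbolic X Y / r ^ 2, by field_simp⟩
  have hc1 : 1 ≤ c := by rw [hc] at hu; nlinarith
  have hg : HasRegularGram .hyperbolic r c ![X, Y] :=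
    hasRegularGram_pair (by simpa [SpaceKind.epsSq] using hX')
      (by simpa [SpaceKind.epsSq] using hY') (by simpa [SpaceKind.epsSq] using hc)
  have hp : 0 < 1 + c := by linarith
  have hsq : √((c - 1) / (1 + c)) ^ 2 = (c - 1) / (1 + c) :=
    Real.sq_sqrt (div_nonneg (by linarith) hp.le)
  have hcτ : c = (1 + √((c - 1) / (1 + c)) ^ 2) / (1 - √((c - 1) / (1 + c)) ^ 2) := by
    have e1 : 1 + (c - 1) / (1 + c) = 2 * c / (1 + c) := by field_simp; ring
    have e2 : 1 - (c - 1) / (1 + c) = 2 / (1 + c) := by field_simp; ring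
    rw [hsq, e1, e2]
    field_simp
  have hτ1 : √((c - 1) / (1 + c)) < 1 := by
    rw [Real.sqrt_lt' one_pos, div_lt_iff₀ hp]
    linarith
  set τ := √((c - 1) / (1 + c))
  rw [hcτ] at hg
  rw [hg.simplexMeasure_one_of_gt (by simp) hr (Real.sqrt_nonneg _) hτ1] at h
  refine ⟨τ, (Real.sqrt_nonneg _).lt_of_ne' fun h0 => ?_, hτ1, h, by rw [hc, ← hcτ]⟩
  rw [h0] at h
  simp at h
  exact ha.ne h

theorem IsRegularTetrahedron.exists_hasRegularGram_of_spherical {r a : ℝ} (hr : 0 < r)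
    {P : Fin 4 → Fin 4 → ℝ} (h : IsRegularTetrahedron .spherical r a P) :
    ∃ c, 0 < 1 + 3 * c ∧ c < 1 ∧ HasRegularGram .spherical r c P := by
  have ha := h.admissible.1
  obtain ⟨τ, hτ, hτa, -⟩ := spherical_edge hr ha (h.mem 0) (h.mem 1) (h.edge 0 1 (by decide))
  -- The bound on the edge says `τ < √2`, which is the same as `0 < 1 + 3 * c`.
  have hτ2 : τ ^ 2 < 2 := by
    have := h.admissible.2 rfl
    rw [← hτa, mul_lt_mul_iff_right₀ (by positivity), Real.arctan_lt_arctan_iff] at this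
    exact (Real.lt_sqrt hτ.le).1 this
  have hp : 0 < 1 + τ ^ 2 := by positivity
  refine ⟨(1 - τ ^ 2) / (1 + τ ^ 2), ?_, ?_, ?_⟩
  · have : 1 + 3 * ((1 - τ ^ 2) / (1 + τ ^ 2)) = 2 * (2 - τ ^ 2) / (1 + τ ^ 2) := by
      field_simp
      ring
    rw [this]
    exact div_pos (by linarith) hp
  · rw [div_lt_one hp]
    nlinarith
  · intro i j
    by_cases hij : i = j
    · subst hij
      have : ambientForm .spherical (P i) (P i) = r ^ 2 := h.mem i
      simp [this, SpaceKind.epsSq]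
    · obtain ⟨σ, -, hσa, hσ⟩ := spherical_edge hr ha (h.mem i) (h.mem j) (h.edge i j hij)
      have : σ = τ := Real.arctan_injective
        (mul_left_cancel₀ (by positivity : 2 * r ≠ 0) (hσa.trans hτa.symm))
      rw [hσ, this]
      simp [hij, SpaceKind.epsSq]

/-- Gives injectivity: equal hyperbolic edge lengths force equal parameters, hence equal Gram
entries. -/
theorem strictMonoOn_log_sub_log :
    StrictMonoOn (fun τ : ℝ => Real.log (1 + τ) - Real.log (1 - τ)) (Set.Ioo 0 1) := by
  intro x hx y hy hxy
  have h1 := Real.log_lt_log (by linarith [hx.1] : 0 < 1 + x) (by linarith : 1 + x < 1 + y)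
  have h2 := Real.log_lt_log (by linarith [hy.2] : 0 < 1 - y) (by linarith : 1 - y < 1 - x)
  simp only
  linarith

theorem IsRegularTetrahedron.exists_hasRegularGram_of_hyperbolic {r a : ℝ} (hr : 0 < r)
    {P : Fin 4 → Fin 4 → ℝ} (h : IsRegularTetrahedron .hyperbolic r a P) :
    ∃ c, 1 < c ∧ HasRegularGram .hyperbolic r c P := by
  have ha := h.admissible.1
  obtain ⟨τ, hτ, hτ1, hτa, -⟩ :=
    hyperbolic_edge hr ha (h.mem 0) (h.mem 1) (h.edge 0 1 (by decide))
  have hp : 0 < 1 - τ ^ 2 := by nlinarith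
  refine ⟨(1 + τ ^ 2) / (1 - τ ^ 2), ?_, ?_⟩
  · rw [one_lt_div hp]
    nlinarith
  · intro i j
    by_cases hij : i = j
    · subst hij
      have : ambientForm .hyperbolic (P i) (P i) = -r ^ 2 := (h.mem i).1
      simp [this, SpaceKind.epsSq]
    · obtain ⟨σ, hσ0, hσ1, hσa, hσ⟩ := hyperbolic_edge hr ha (h.mem i) (h.mem j) (h.edge i j hij)
      have : σ = τ := strictMonoOn_log_sub_log.injOn ⟨hσ0, hσ1⟩ ⟨hτ, hτ1⟩
        (mul_left_cancel₀ hr.ne' (hσa.trans hτa.symm))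
      rw [hσ, this]
      simp [hij, SpaceKind.epsSq]

/-! ### The flat tetrahedron. -/

theorem inducedMetric_euclidean (r : ℝ) {k : ℕ} (P : Fin (k + 1) → Fin 4 → ℝ) (t : Fin k → ℝ)
    (i j : Fin k) :
    inducedMetric .euclidean r P t i j =
      ambientForm .euclidean (P i.succ - P 0) (P j.succ - P 0) := by
  have hg : geodesicSimplex .euclidean r P = fun t =>
      (1 - ∑ i, t i) • P 0 + ∑ i, t i • P i.succ := rfl
  have hd : DifferentiableAt ℝ (geodesicSimplex .euclidean r P) t := by
    rw [hg]
    fun_prop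
  have h : ∀ i, fderiv ℝ (geodesicSimplex .euclidean r P) t (Pi.single i 1) =
      P i.succ - P 0 := by
    intro i
    rw [← hd.lineDeriv_eq_fderiv, lineDeriv, hg]
    simp only [sum_baryCoord_smul, sum_baryCoord_add_single, sum_edgeWeight_smul]
    have := ((hasDerivAt_id (0 : ℝ)).smul_const (P i.succ - P 0)).const_add
      (∑ j, baryCoord t j • P j)
    simpa using this.deriv
  simp only [inducedMetric, Matrix.of_apply, h]

theorem simplexMeasure_euclidean_one (r : ℝ) (X Y : Fin 4 → ℝ) :
    simplexMeasure .euclidean r (k := 1) ![X, Y] = √(ambientForm .euclidean (Y - X) (Y - X)) := by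
  have h0 : 0 ≤ ambientForm .euclidean (Y - X) (Y - X) := by
    simp only [ambientForm, SpaceKind.epsSq]
    nlinarith [mul_self_nonneg ((Y - X) 0), mul_self_nonneg ((Y - X) 1),
      mul_self_nonneg ((Y - X) 2), mul_self_nonneg ((Y - X) 3)]
  simp only [simplexMeasure, Matrix.det_fin_one, inducedMetric_euclidean]
  simp only [Fin.succ_zero_eq_one, Matrix.cons_val_zero, Matrix.cons_val_one, abs_of_nonneg h0]
  rw [← mul_one √_, integral_const_mul, setIntegral_cornerSimplex_one_one]

theorem IsRegularTetrahedron.ambientForm_sub_euclidean {r a : ℝ} {P : Fin 4 → Fin 4 → ℝ}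
    (h : IsRegularTetrahedron .euclidean r a P) {i j : Fin 4} (hij : i ≠ j) :
    ambientForm .euclidean (P j - P i) (P j - P i) = a ^ 2 := by
  have := h.edge i j hij
  rw [simplexMeasure_euclidean_one, Real.sqrt_eq_iff_mul_self_eq_of_pos h.admissible.1] at this
  rw [← this, sq]

/-- Polarization: the three squared side lengths determine the product of two edge vectors. -/
theorem IsRegularTetrahedron.ambientForm_sub_sub_euclidean {r a : ℝ} {P : Fin 4 → Fin 4 → ℝ}
    (h : IsRegularTetrahedron .euclidean r a P) {i j l : Fin 4} (hi : l ≠ i) (hj : l ≠ j) :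
    ambientForm .euclidean (P i - P l) (P j - P l) = if i = j then a ^ 2 else a ^ 2 / 2 := by
  by_cases hij : i = j
  · subst hij
    simp [h.ambientForm_sub_euclidean hi]
  · have h1 := h.ambientForm_sub_euclidean hi
    have h2 := h.ambientForm_sub_euclidean hj
    have h3 := h.ambientForm_sub_euclidean hij
    rw [if_neg hij]
    simp only [ambientForm, SpaceKind.epsSq, Pi.sub_apply] at *
    linarith

theorem IsRegularTetrahedron.faceArea_euclidean {r a : ℝ} {P : Fin 4 → Fin 4 → ℝ}
    (h : IsRegularTetrahedron .euclidean r a P) (f : Fin 4) :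
    faceArea .euclidean r P f = √3 / 4 * a ^ 2 := by
  have hn : ∀ i : Fin 2, f.succAbove 0 ≠ f.succAbove i.succ := fun i he =>
    (Fin.succ_ne_zero i) (f.succAbove_right_injective he).symm
  simp only [faceArea, simplexMeasure, Matrix.det_fin_two, inducedMetric_euclidean,
    h.ambientForm_sub_sub_euclidean (hn _) (hn _), f.succAbove_right_injective.eq_iff]
  have e : √(|a ^ 2 * a ^ 2 - a ^ 2 / 2 * (a ^ 2 / 2)|) = √3 / 2 * a ^ 2 := by
    have : a ^ 2 * a ^ 2 - a ^ 2 / 2 * (a ^ 2 / 2) = 3 * (a ^ 2 / 2) ^ 2 := by ring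
    rw [this, abs_of_nonneg (by positivity), Real.sqrt_mul (by norm_num),
      Real.sqrt_sq (by positivity)]
    ring
  simp only [Fin.succ_inj, if_true, zero_ne_one, one_ne_zero, if_false, e]
  rw [← mul_one (√3 / 2 * a ^ 2), integral_const_mul, setIntegral_cornerSimplex_two_one]
  ring

theorem IsRegularTetrahedron.tetraVolume_euclidean {r a : ℝ} {P : Fin 4 → Fin 4 → ℝ}
    (h : IsRegularTetrahedron .euclidean r a P) :
    tetraVolume .euclidean r P = √2 / 12 * a ^ 3 := by
  have ha := h.admissible.1
  have hn : ∀ i : Fin 3, (0 : Fin 4) ≠ i.succ := fun i => (Fin.succ_ne_zero i).symm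
  simp only [tetraVolume, simplexMeasure, Matrix.det_fin_three, inducedMetric_euclidean,
    h.ambientForm_sub_sub_euclidean (hn _) (hn _)]
  simp only [Fin.succ_inj, Fin.reduceEq, if_true, if_false]
  have e : ∀ x : ℝ, x = 2 * (a ^ 3 / 2) ^ 2 → √|x| = √2 / 2 * a ^ 3 := by
    intro x hx
    rw [hx, abs_of_nonneg (by positivity), Real.sqrt_mul (by norm_num),
      Real.sqrt_sq (by positivity)]
    ring
  rw [e _ (by ring), ← mul_one (√2 / 2 * a ^ 3), integral_const_mul,
    setIntegral_cornerSimplex_three_one]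
  ring

theorem IsRegularTetrahedron.volumeAreaRatio_euclidean {r a : ℝ} {P : Fin 4 → Fin 4 → ℝ}
    (h : IsRegularTetrahedron .euclidean r a P) (f : Fin 4) :
    volumeAreaRatio .euclidean r P f = euclideanRatio := by
  have ha := h.admissible.1
  have e : (a ^ 2) ^ (3 / 2 : ℝ) = a ^ 3 := by
    rw [← Real.rpow_natCast, ← Real.rpow_mul ha.le, ← Real.rpow_natCast]
    norm_num
  rw [volumeAreaRatio, h.faceArea_euclidean, h.tetraVolume_euclidean,
    Real.mul_rpow (by positivity) (by positivity), e, euclideanRatio]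
  have : a ^ 3 ≠ 0 := by positivity
  field_simp

/-! ### Existence of regular tetrahedra. -/

/-- The vertices of a regular tetrahedron inscribed in a cube with edges of length `2 x`. -/
def cubeTetrahedron (x y : ℝ) : Fin 4 → Fin 4 → ℝ :=
  ![![x, x, x, y], ![x, -x, -x, y], ![-x, x, -x, y], ![-x, -x, x, y]]

theorem ambientForm_cubeTetrahedron (K : SpaceKind) (x y : ℝ) (i j : Fin 4) :
    ambientForm K (cubeTetrahedron x y i) (cubeTetrahedron x y j) =
      (if i = j then 3 * x ^ 2 else -x ^ 2) + K.epsSq * y ^ 2 := by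
  fin_cases i <;> fin_cases j <;> simp [ambientForm, cubeTetrahedron] <;> ring

/-- Diagonal and off-diagonal Gram entries differ by `4 * x ^ 2`, and a row of the Gram matrix sums
to `4 * K.epsSq * y ^ 2`. This determines `x` and `y` up to sign. -/
theorem hasRegularGram_cubeTetrahedron {K : SpaceKind} {r c x y : ℝ}
    (hx : 4 * x ^ 2 = K.epsSq * r ^ 2 * (1 - c)) (hy : 4 * y ^ 2 = r ^ 2 * (1 + 3 * c)) :
    HasRegularGram K r c (cubeTetrahedron x y) := by
  intro i j
  rw [ambientForm_cubeTetrahedron]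
  split_ifs
  · linear_combination (K.epsSq / 4) * hy + 3 / 4 * hx
  · linear_combination (K.epsSq / 4) * hy - 1 / 4 * hx

theorem exists_isRegularTetrahedron_euclidean {r a : ℝ} (ha : AdmissibleEdge .euclidean r a) :
    ∃ P, IsRegularTetrahedron .euclidean r a P := by
  -- The edges are face diagonals of a cube of side `2 * x`, so their length is `√8 * x`.
  refine ⟨cubeTetrahedron (a / √8) 0, ha, fun i => ?_, fun i j hij => ?_⟩
  · change cubeTetrahedron (a / √8) 0 i 3 = 0
    fin_cases i <;> rfl
  · have h0 := ha.1
    have e : ∀ X Y : Fin 4 → ℝ, ambientForm .euclidean (Y - X) (Y - X) =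
        ambientForm .euclidean Y Y + ambientForm .euclidean X X -
          2 * ambientForm .euclidean Y X := by
      intro X Y
      simp [ambientForm]
      ring
    have e2 : (a / √8) ^ 2 = a ^ 2 / 8 := by rw [div_pow, Real.sq_sqrt (by norm_num)]
    rw [simplexMeasure_euclidean_one, e]
    simp only [ambientForm_cubeTetrahedron, if_true, if_neg (Ne.symm hij), e2]
    rw [Real.sqrt_eq_iff_mul_self_eq_of_pos h0]
    ring

theorem exists_isRegularTetrahedron_spherical {r a : ℝ} (hr : 0 < r)
    (ha : AdmissibleEdge .spherical r a) : ∃ P, IsRegularTetrahedron .spherical r a P := by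
  have h2 : a / (2 * r) < Real.arctan √2 := by
    rw [div_lt_iff₀ (by positivity)]
    linarith [ha.2 rfl]
  have h0 : 0 < a / (2 * r) := div_pos ha.1 (by positivity)
  have hπ : a / (2 * r) < Real.pi / 2 := h2.trans (Real.arctan_lt_pi_div_two _)
  obtain ⟨τ, hτ⟩ : ∃ τ, Real.arctan τ = a / (2 * r) :=
    ⟨Real.tan (a / (2 * r)), Real.arctan_tan (by linarith) hπ⟩
  have hτ0 : 0 < τ := by rwa [← hτ, ← Real.arctan_zero, Real.arctan_lt_arctan_iff] at h0
  have hτ2 : τ ^ 2 < 2 := by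
    rw [← hτ, Real.arctan_lt_arctan_iff] at h2
    exact (Real.lt_sqrt hτ0.le).1 h2
  have e1 : 1 - (1 - τ ^ 2) / (1 + τ ^ 2) = 2 * τ ^ 2 / (1 + τ ^ 2) := by field_simp; ring
  have e2 : 1 + 3 * ((1 - τ ^ 2) / (1 + τ ^ 2)) = 2 * (2 - τ ^ 2) / (1 + τ ^ 2) := by
    field_simp
    ring
  have hp1 : 0 ≤ r ^ 2 * (2 * τ ^ 2 / (1 + τ ^ 2)) / 4 := by positivity
  -- The common height `y` is real because `τ ^ 2 < 2`, that is, because the edge is admissible.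
  have hp2 : 0 ≤ r ^ 2 * (2 * (2 - τ ^ 2) / (1 + τ ^ 2)) / 4 := by
    have : 0 < 2 - τ ^ 2 := by linarith
    positivity
  have hg : HasRegularGram .spherical r ((1 - τ ^ 2) / (1 + τ ^ 2))
      (cubeTetrahedron √(r ^ 2 * (2 * τ ^ 2 / (1 + τ ^ 2)) / 4)
        √(r ^ 2 * (2 * (2 - τ ^ 2) / (1 + τ ^ 2)) / 4)) := by
    apply hasRegularGram_cubeTetrahedron
    · rw [e1, Real.sq_sqrt hp1]
      simp only [SpaceKind.epsSq]
      ring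
    · rw [e2, Real.sq_sqrt hp2]
      ring
  refine ⟨cubeTetrahedron √(r ^ 2 * (2 * τ ^ 2 / (1 + τ ^ 2)) / 4)
    √(r ^ 2 * (2 * (2 - τ ^ 2) / (1 + τ ^ 2)) / 4), ha, fun i => ?_, fun i j hij => ?_⟩
  rotate_left
  · have hinj : Function.Injective ![i, j] := by
      intro k l
      fin_cases k <;> fin_cases l <;> simp [hij, Ne.symm hij]
    have hpair := hg.comp hinj
    have := hpair.simplexMeasure_one_of_lt (by simp) hr hτ0.le
    rw [hτ] at this
    convert this using 1
    · congr 1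
      funext k
      fin_cases k <;> rfl
    · field_simp
  · refine (hg i i).trans ?_
    simp [SpaceKind.epsSq]

theorem exists_isRegularTetrahedron_hyperbolic {r a : ℝ} (hr : 0 < r)
    (ha : AdmissibleEdge .hyperbolic r a) : ∃ P, IsRegularTetrahedron .hyperbolic r a P := by
  have h0 : 0 < a / r := div_pos ha.1 hr
  obtain ⟨τ, hτ0, hτ1, hτ⟩ : ∃ τ : ℝ, 0 < τ ∧ τ < 1 ∧
      Real.log (1 + τ) - Real.log (1 - τ) = a / r := by
    have hE : 1 < Real.exp (a / r) := Real.one_lt_exp_iff.2 h0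
    -- The witness is tanh (a / (2r)).
    refine ⟨(Real.exp (a / r) - 1) / (Real.exp (a / r) + 1), div_pos (by linarith) (by linarith),
      (div_lt_one (by linarith)).2 (by linarith), ?_⟩
    have hp : 0 < Real.exp (a / r) + 1 := by linarith
    have e1 : 1 + (Real.exp (a / r) - 1) / (Real.exp (a / r) + 1) =
        Real.exp (a / r) * (2 / (Real.exp (a / r) + 1)) := by field_simp; ring
    have e2 : 1 - (Real.exp (a / r) - 1) / (Real.exp (a / r) + 1) =
        2 / (Real.exp (a / r) + 1) := by field_simp; ring
    rw [e1, e2, Real.log_mul (by positivity) (by positivity), Real.log_exp]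
    ring
  have hq : 0 < 1 - τ ^ 2 := by nlinarith
  have e1 : 1 - (1 + τ ^ 2) / (1 - τ ^ 2) = -(2 * τ ^ 2 / (1 - τ ^ 2)) := by field_simp; ring
  have e2 : 1 + 3 * ((1 + τ ^ 2) / (1 - τ ^ 2)) = 2 * (2 + τ ^ 2) / (1 - τ ^ 2) := by
    field_simp
    ring
  have hp1 : 0 ≤ r ^ 2 * (2 * τ ^ 2 / (1 - τ ^ 2)) / 4 := by positivity
  have hp2 : 0 < r ^ 2 * (2 * (2 + τ ^ 2) / (1 - τ ^ 2)) / 4 := by positivity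
  have hg : HasRegularGram .hyperbolic r ((1 + τ ^ 2) / (1 - τ ^ 2))
      (cubeTetrahedron √(r ^ 2 * (2 * τ ^ 2 / (1 - τ ^ 2)) / 4)
        √(r ^ 2 * (2 * (2 + τ ^ 2) / (1 - τ ^ 2)) / 4)) := by
    apply hasRegularGram_cubeTetrahedron
    · rw [e1, Real.sq_sqrt hp1]
      simp only [SpaceKind.epsSq]
      ring
    · rw [e2, Real.sq_sqrt hp2.le]
      ring
  refine ⟨cubeTetrahedron √(r ^ 2 * (2 * τ ^ 2 / (1 - τ ^ 2)) / 4)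
    √(r ^ 2 * (2 * (2 + τ ^ 2) / (1 - τ ^ 2)) / 4), ha, fun i => ⟨?_, ?_⟩, fun i j hij => ?_⟩
  rotate_left 2
  · have hinj : Function.Injective ![i, j] := by
      intro k l
      fin_cases k <;> fin_cases l <;> simp [hij, Ne.symm hij]
    have hpair := hg.comp hinj
    have := hpair.simplexMeasure_one_of_gt (by simp) hr hτ0.le hτ1
    rw [hτ] at this
    convert this using 1
    · congr 1
      funext k
      fin_cases k <;> rfl
    · field_simp
  · refine (hg i i).trans ?_
    simp [SpaceKind.epsSq]
  · have := Real.sqrt_pos.2 hp2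
    fin_cases i <;> exact this

theorem exists_isRegularTetrahedron {K : SpaceKind} {r a : ℝ} (hr : 0 < r)
    (ha : AdmissibleEdge K r a) : ∃ P, IsRegularTetrahedron K r a P := by
  cases K
  · exact exists_isRegularTetrahedron_spherical hr ha
  · exact exists_isRegularTetrahedron_euclidean ha
  · exact exists_isRegularTetrahedron_hyperbolic hr ha

/-! ### Conclusion: strict inequalities in the curved spaces and the trichotomy. -/

theorem IsRegularTetrahedron.lt_volumeAreaRatio_spherical {r a : ℝ} (hr : 0 < r)
    {P : Fin 4 → Fin 4 → ℝ} (h : IsRegularTetrahedron .spherical r a P) (f : Fin 4) :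
    euclideanRatio < volumeAreaRatio .spherical r P f := by
  obtain ⟨c, hc, h1, hg⟩ := h.exists_hasRegularGram_of_spherical hr
  exact hg.lt_volumeAreaRatio (by simp) hr hc h1 f

theorem IsRegularTetrahedron.volumeAreaRatio_hyperbolic_lt {r a : ℝ} (hr : 0 < r)
    {P : Fin 4 → Fin 4 → ℝ} (h : IsRegularTetrahedron .hyperbolic r a P) (f : Fin 4) :
    volumeAreaRatio .hyperbolic r P f < euclideanRatio := by
  obtain ⟨c, h1, hg⟩ := h.exists_hasRegularGram_of_hyperbolic hr
  exact hg.volumeAreaRatio_lt (by simp) hr h1 f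

theorem mainTheorem5 :
    -- the decimal value of the constant
    |euclideanRatio - 0.4136| < 0.00005 ∧
    ∀ r a : ℝ, 0 < r →
      -- regular tetrahedra of every admissible edge length exist
      (∀ K : SpaceKind, AdmissibleEdge K r a → ∃ P, IsRegularTetrahedron K r a P) ∧
      -- the Euclidean value
      (∀ P f, IsRegularTetrahedron .euclidean r a P →
        volumeAreaRatio .euclidean r P f = euclideanRatio) ∧
      -- hyperbolic versus Euclidean
      (∀ P Q f g, IsRegularTetrahedron .hyperbolic r a P → IsRegularTetrahedron .euclidean r a Q →
        volumeAreaRatio .hyperbolic r P f ≤ volumeAreaRatio .euclidean r Q g) ∧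
      -- Euclidean versus spherical
      (∀ P Q f g, IsRegularTetrahedron .euclidean r a P → IsRegularTetrahedron .spherical r a Q →
        volumeAreaRatio .euclidean r P f ≤ volumeAreaRatio .spherical r Q g) ∧
      -- the ratio decides the geometry
      (∀ (K : SpaceKind) P f, IsRegularTetrahedron K r a P →
        (volumeAreaRatio K r P f > euclideanRatio ↔ K = .spherical) ∧
        (volumeAreaRatio K r P f = euclideanRatio ↔ K = .euclidean) ∧
        (volumeAreaRatio K r P f < euclideanRatio ↔ K = .hyperbolic)) := by
  refine ⟨abs_euclideanRatio_sub_lt, fun r a hr => ⟨fun K ha => exists_isRegularTetrahedron hr ha,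
    fun P f h => h.volumeAreaRatio_euclidean f, fun P Q f g hP hQ => ?_, fun P Q f g hP hQ => ?_,
    fun K P f h => ?_⟩⟩
  · rw [hQ.volumeAreaRatio_euclidean]
    exact (hP.volumeAreaRatio_hyperbolic_lt hr f).le
  · rw [hP.volumeAreaRatio_euclidean]
    exact (hQ.lt_volumeAreaRatio_spherical hr g).le
  · cases K
    · have := h.lt_volumeAreaRatio_spherical hr f
      simp [this, this.ne', this.le]
    · have := h.volumeAreaRatio_euclidean f
      simp [this]
    · have := h.volumeAreaRatio_hyperbolic_lt hr f
      simp [this, this.ne, this.le]
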